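/- Let $n\ge 1$, $0<\kappa<1$, and write $B(x,r)$ for the open Euclidean balls of $\mathbb R^n$. A weight is a locally integrable function $w$ on $\mathbb R^n$ with $w>0$ almost everywhere; $w(E)=\int_E w\,dx$. For $1<p<\infty$ and $p'=p/(p-1)$, $w\in A_p$ means $\sup_B\big(\frac1{|B|}\int_B w\big)\big(\frac1{|B|}\int_B w^{1-p'}\big)^{p-1}<\infty$, and $w\in A_1$ means that, for some $C$, $\frac1{|B|}\int_B w\le C\,\operatorname{ess\,inf}_B w$ for every ball $B$. For $1\le p<\infty$ let $\|f\|_{L_{p,w}(B)}=\big(\int_B|f|^pw\,dx\big)^{1/p}$ (with $L_p(w)$ the corresponding space on $\mathbb R^n$), $\|f\|_{WL_{p,w}(B)}=\sup_{t>0}t\,w(\{y\in B:|f(y)|>t\})^{1/p}$ (with $WL_p(w)$ the space on $\mathbb R^n$), $$\|f\|_{L_{p,\kappa}(w)}=\sup_{B}w(B)^{-\kappa/p}\|f\|_{L_{p,w}(B)},\qquad \|f\|_{WL_{p,\kappa}(w)}=\sup_{B}w(B)^{-\kappa/p}\|f\|_{WL_{p,w}(B)},$$ let $L_{p,\kappa}(w)$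 be the space of locally integrable $f$ with $\|f\|_{L_{p,\kappa}(w)}<\infty$, and $WL_{p,\kappa}(w)$ the space of measurable $f$ with $\|f\|_{WL_{p,\kappa}(w)}<\infty$. $BMO$ is the space of locally integrable $b$ with $\sup_B\frac1{|B|}\int_B|b-b_B|<\infty$, where $b_B=\frac1{|B|}\int_Bb$. Functions are real- or complex-valued. Let $T$ be a sublinear operator on a linear space $D$ of functions, with measurable values: $|T(f+g)|\le|Tf|+|Tg|$ and $|T(\lambda f)|=|\lambda||Tf|$ almost everywhere. For a kernel $K\ge0$, say that $T$ satisfies the size estimate with kernel $K$ and constant $c$ at $f\in D$ if $$|Tf(x)|\le c\int_{\mathbb R^n}K(x,y)|f(y)|\,dy\qquad\text{for a.e. }x\notin\operatorname{supp}f,$$ and that it satisfies the size condition with kernel $K$ if there is one $c_0$ such that this holds with $c=c_0$ for all $f\in D\cap L_1(\mathbb R^n)$ with compact support. Condition (e1) (with $\Omega\equiv1$) is the size condition with $K(x,y)=|x-y|^{-n}$, and condition (e2), for $b\in BMO$, is the one with $K(x,y)=|b(x)-b(y)||x-y|^{-n}$. "$T$ is bounded on $L_{p,\kappa}(w)$"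 means: there is a constant $C$ such that for every $f\in L_{p,\kappa}(w)$ there is $F\in L_{p,\kappa}(w)$ with $\|F\|_{L_{p,\kappa}(w)}\le C\|f\|_{L_{p,\kappa}(w)}$ that is the value of $T$ at $f$ in the following sense: $|T(f\chi_{B(0,k)})|\to|F|$ almost everywhere as $k\to\infty$; and $F=Tf$ whenever $f\in L_p(w)$, or $f\in D$ and, for some constant $c$, $T$ satisfies the size estimate with constant $c$ also at all the (not compactly supported) functions $f\chi_{\mathbb R^n\setminus B(0,R)}$, $R>0$. "$T$ is bounded from $L_{1,\kappa}(w)$ to $WL_{1,\kappa}(w)$" is understood in the same way, with $F\in WL_{1,\kappa}(w)$ and $\|F\|_{WL_{1,\kappa}(w)}\le C\|f\|_{L_{1,\kappa}(w)}$. (1) Let $T$ satisfy (e1). If $1<p<\infty$, $w\in A_p$, $L_p(w)\subset D$ and $T$ is bounded on $L_p(w)$, then $T$ is bounded on $L_{p,\kappa}(w)$. If $w\in A_1$, $L_1(w)\subset D$ and $T$ is bounded from $L_1(w)$ to $WL_1(w)$, then $T$ is bounded from $L_{1,\kappa}(w)$ to $WL_{1,\kappa}(w)$. (2) Let $b\in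 BMO$, $1<p<\infty$, $w\in A_p$, and let $T_b=T$ satisfy (e2), with $L_p(w)\subset D$ and $T_b$ bounded on $L_p(w)$. Then $T_b$ is bounded on $L_{p,\kappa}(w)$. -/

import Mathlib

open MeasureTheory Metric Set Filter Topology
open scoped NNReal ENNReal

noncomputable section

namespace WeightedMorrey

/-- `ℝⁿ` with the Euclidean norm. -/
abbrev Eu (n : ℕ) : Type := EuclideanSpace ℝ (Fin n)

variable {n : ℕ} {𝕜 : Type*} [RCLike 𝕜]

/-! ### Weights -/

/-- A weight: a locally integrable function that is positive almost everywhere. -/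
structure IsWeight (w : Eu n → ℝ) : Prop where
  locallyIntegrable : LocallyIntegrable w volume
  pos : ∀ᵐ x, 0 < w x

/-- The measure `w(x) dx`; its value on `E` is `w(E) = ∫_E w`. -/
def wMeas (w : Eu n → ℝ) : Measure (Eu n) :=
  volume.withDensity fun x => ENNReal.ofReal (w x)

/-- The characteristic constant
`[w]_{A_p} = sup_B (|B|⁻¹ ∫_B w) (|B|⁻¹ ∫_B w^{1-p'})^{p-1}`, `p' = p / (p - 1)`, for `1 < p`. -/
def apConst (p : ℝ) (w : Eu n → ℝ) : ℝ≥0∞ :=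
  ⨆ (x : Eu n) (r : ℝ) (_ : 0 < r),
    (⨍⁻ y in ball x r, ENNReal.ofReal (w y) ∂volume) *
      (⨍⁻ y in ball x r, ENNReal.ofReal (w y) ^ (1 - p / (p - 1)) ∂volume) ^ (p - 1)

/-- The Muckenhoupt class `A_p` for `1 < p < ∞`. -/
structure IsAp (p : ℝ) (w : Eu n → ℝ) : Prop where
  isWeight : IsWeight w
  apConst_lt_top : apConst p w < ∞

/-- The Muckenhoupt class `A_1`: `|B|⁻¹ ∫_B w ≤ C ess inf_B w` for every ball `B`. -/
structure IsA1 (w : Eu n → ℝ) : Prop where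
  isWeight : IsWeight w
  average_le : ∃ C : ℝ≥0, ∀ (x : Eu n) (r : ℝ), 0 < r →
    ∀ᵐ z ∂(volume.restrict (ball x r)),
      (⨍⁻ y in ball x r, ENNReal.ofReal (w y) ∂volume) ≤ C * ENNReal.ofReal (w z)

/-! ### Function spaces -/

/-- The weak norm `sup_{t > 0} t μ{|f| > t}^{1/p}`. -/
def weakNorm (p : ℝ) (μ : Measure (Eu n)) (f : Eu n → 𝕜) : ℝ≥0∞ :=
  ⨆ t : ℝ≥0, (t : ℝ≥0∞) * μ {x | (t : ℝ≥0∞) < ‖f x‖ₑ} ^ (1 / p)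

/-- `‖f‖_{L_{p,κ}(w)} = sup_B w(B)^{-κ/p} ‖f‖_{L_{p,w}(B)}`. -/
def morreyNorm (p κ : ℝ) (w : Eu n → ℝ) (f : Eu n → 𝕜) : ℝ≥0∞ :=
  ⨆ (x : Eu n) (r : ℝ) (_ : 0 < r),
    wMeas w (ball x r) ^ (-κ / p) *
      eLpNorm f (ENNReal.ofReal p) ((wMeas w).restrict (ball x r))

/-- `‖f‖_{WL_{p,κ}(w)} = sup_B w(B)^{-κ/p} ‖f‖_{WL_{p,w}(B)}`. -/
def weakMorreyNorm (p κ : ℝ) (w : Eu n → ℝ) (f : Eu n → 𝕜) : ℝ≥0∞ :=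
  ⨆ (x : Eu n) (r : ℝ) (_ : 0 < r),
    wMeas w (ball x r) ^ (-κ / p) * weakNorm p ((wMeas w).restrict (ball x r)) f

/-- The weighted Morrey space `L_{p,κ}(w)`. -/
structure MemMorrey (p κ : ℝ) (w : Eu n → ℝ) (f : Eu n → 𝕜) : Prop where
  locallyIntegrable : LocallyIntegrable f volume
  norm_lt_top : morreyNorm p κ w f < ∞

/-- The weak weighted Morrey space `WL_{p,κ}(w)`. -/
structure MemWeakMorrey (p κ : ℝ) (w : Eu n → ℝ) (f : Eu n → 𝕜) : Prop where
  aestronglyMeasurable : AEStronglyMeasurable f volume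
  norm_lt_top : weakMorreyNorm p κ w f < ∞

/-- `‖b‖_* = sup_B |B|⁻¹ ∫_B |b - b_B|`. -/
def bmoNorm (b : Eu n → 𝕜) : ℝ≥0∞ :=
  ⨆ (x : Eu n) (r : ℝ) (_ : 0 < r),
    ⨍⁻ y in ball x r, ‖b y - (⨍ z in ball x r, b z ∂volume)‖ₑ ∂volume

/-- The space `BMO(ℝⁿ)`. -/
structure MemBMO (b : Eu n → 𝕜) : Prop where
  locallyIntegrable : LocallyIntegrable b volume
  norm_lt_top : bmoNorm b < ∞

/-! ### Sublinear operators and size conditions -/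

/-- `T` is a sublinear operator with domain the linear space `D`, with measurable values. -/
structure IsSublinearOn (D : Submodule 𝕜 (Eu n → 𝕜)) (T : (Eu n → 𝕜) → Eu n → 𝕜) : Prop where
  measurable : ∀ f ∈ D, AEStronglyMeasurable (T f) volume
  add_le : ∀ f ∈ D, ∀ g ∈ D, ∀ᵐ x, ‖T (f + g) x‖ ≤ ‖T f x‖ + ‖T g x‖
  smul_eq : ∀ (c : 𝕜), ∀ f ∈ D, ∀ᵐ x, ‖T (c • f) x‖ = ‖c‖ * ‖T f x‖

/-- The kernel `|x - y|⁻ⁿ`. -/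
def czKernel (x y : Eu n) : ℝ≥0∞ := (‖x - y‖ₑ ^ n)⁻¹

/-- The kernel `|b(x) - b(y)| |x - y|⁻ⁿ`. -/
def commKernel (b : Eu n → 𝕜) (x y : Eu n) : ℝ≥0∞ := ‖b x - b y‖ₑ * (‖x - y‖ₑ ^ n)⁻¹

/-- The pointwise size estimate off the support, for the single function `f`:
`|T f(x)| ≤ c ∫ K(x, y) |f(y)| dy` for almost every `x ∉ supp f`. -/
def SizeEstimate (K : Eu n → Eu n → ℝ≥0∞) (T : (Eu n → 𝕜) → Eu n → 𝕜) (c : ℝ≥0)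
    (f : Eu n → 𝕜) : Prop :=
  ∀ᵐ x, x ∉ tsupport f → ‖T f x‖ₑ ≤ c * ∫⁻ y, K x y * ‖f y‖ₑ

/-- The size condition with kernel `K`: the estimate holds, with one constant, for all
integrable functions with compact support on which `T` is defined. -/
def SizeCondition (K : Eu n → Eu n → ℝ≥0∞) (D : Submodule 𝕜 (Eu n → 𝕜))
    (T : (Eu n → 𝕜) → Eu n → 𝕜) : Prop :=
  ∃ c : ℝ≥0, ∀ f ∈ D, MemLp f 1 volume → HasCompactSupport f → SizeEstimate K T c f

/-- `T` is (defined and) bounded on `L_p(w)`. -/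
def BoundedOnLp (p : ℝ) (w : Eu n → ℝ) (D : Submodule 𝕜 (Eu n → 𝕜))
    (T : (Eu n → 𝕜) → Eu n → 𝕜) : Prop :=
  ∃ A : ℝ≥0, ∀ f : Eu n → 𝕜, MemLp f (ENNReal.ofReal p) (wMeas w) → f ∈ D ∧
    eLpNorm (T f) (ENNReal.ofReal p) (wMeas w) ≤ A * eLpNorm f (ENNReal.ofReal p) (wMeas w)

/-- `T` is (defined on `L_1(w)` and) bounded from `L_1(w)` to `WL_1(w)`. -/
def BoundedWeakL1 (w : Eu n → ℝ) (D : Submodule 𝕜 (Eu n → 𝕜))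
    (T : (Eu n → 𝕜) → Eu n → 𝕜) : Prop :=
  ∃ A : ℝ≥0, ∀ f : Eu n → 𝕜, MemLp f 1 (wMeas w) → f ∈ D ∧
    weakNorm 1 (wMeas w) (T f) ≤ A * eLpNorm f 1 (wMeas w)

/-- `F` is the value of `T` at `f`, up to a unimodular factor if `T` does not itself provide it:
`|T(f χ_{B(0,k)})| → |F|` almost everywhere as `k → ∞`; and `F` is `T f` itself as soon as
`f ∈ L_p(w)`, or `f` is in the domain of `T` and the size estimate holds
for the functions `f χ_{ℝⁿ ∖ B(0,R)}` too, which need not have compact support. -/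
structure IsValue (K : Eu n → Eu n → ℝ≥0∞) (p : ℝ) (w : Eu n → ℝ)
    (D : Submodule 𝕜 (Eu n → 𝕜)) (T : (Eu n → 𝕜) → Eu n → 𝕜) (f F : Eu n → 𝕜) : Prop where
  tendsto : ∀ᵐ x, Tendsto (fun k : ℕ => ‖T ((ball (0 : Eu n) k).indicator f) x‖)
    atTop (𝓝 ‖F x‖)
  eq_of_memLp : MemLp f (ENNReal.ofReal p) (wMeas w) → F = T f
  eq_of_sizeEstimate : f ∈ D →
    (∃ c : ℝ≥0, ∀ R : ℝ, 0 < R → SizeEstimate K T c ((ball (0 : Eu n) R)ᶜ.indicator f)) →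
    F = T f

/-- `T` is bounded on `L_{p,κ}(w)`. -/
def BoundedOnMorrey (K : Eu n → Eu n → ℝ≥0∞) (p κ : ℝ) (w : Eu n → ℝ)
    (D : Submodule 𝕜 (Eu n → 𝕜)) (T : (Eu n → 𝕜) → Eu n → 𝕜) : Prop :=
  ∃ C : ℝ≥0, ∀ f : Eu n → 𝕜, MemMorrey p κ w f →
    ∃ F : Eu n → 𝕜, IsValue K p w D T f F ∧
      MemMorrey p κ w F ∧ morreyNorm p κ w F ≤ C * morreyNorm p κ w f

/-- `T` is bounded from `L_{p,κ}(w)` to `WL_{p,κ}(w)`. -/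
def BoundedToWeakMorrey (K : Eu n → Eu n → ℝ≥0∞) (p κ : ℝ) (w : Eu n → ℝ)
    (D : Submodule 𝕜 (Eu n → 𝕜)) (T : (Eu n → 𝕜) → Eu n → 𝕜) : Prop :=
  ∃ C : ℝ≥0, ∀ f : Eu n → 𝕜, MemMorrey p κ w f →
    ∃ F : Eu n → 𝕜, IsValue K p w D T f F ∧
      MemWeakMorrey p κ w F ∧ weakMorreyNorm p κ w F ≤ C * morreyNorm p κ w f

end WeightedMorrey

end

noncomputable section

namespace WeightedMorrey

variable {n : ℕ} {𝕜 : Type*} [RCLike 𝕜]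

/-- A measure on `ℝⁿ` that is finite and positive on balls and controls averages of functions over
balls by their weighted `L_p` averages; this is a reformulation of the `A_p` condition. -/
structure IsMuckenhoupt (p : ℝ) (C : ℝ≥0) (ν : Measure (Eu n)) : Prop where
  ac : ν ≪ volume
  pos : ∀ (x : Eu n) (r : ℝ), 0 < r → 0 < ν (ball x r)
  lt_top : ∀ (x : Eu n) (r : ℝ), ν (ball x r) < ∞
  lintegral_mul_le : ∀ (x : Eu n) (r : ℝ), 0 < r → ∀ g : Eu n → ℝ≥0∞, AEMeasurable g volume →
    (∫⁻ y in ball x r, g y) * ν (ball x r) ^ (1 / p) ≤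
      C * volume (ball x r) * (∫⁻ y in ball x r, g y ^ p ∂ν) ^ (1 / p)

theorem volume_ball_le_mul (x y : Eu n) {R s : ℝ} (K : ℝ≥0) (hs : 0 < s) (hR : R ≤ K * s) :
    volume (ball x R) ≤ ((K ^ n : ℝ≥0) : ℝ≥0∞) * volume (ball y s) := by
  rcases le_or_gt R 0 with h | h
  · simp [ball_eq_empty.2 h]
  rw [Measure.addHaar_ball_of_pos _ _ h, Measure.addHaar_ball_of_pos _ _ hs, ← mul_assoc]
  gcongr
  rw [← ENNReal.ofReal_coe_nnreal, ← ENNReal.ofReal_mul (by positivity)]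
  apply ENNReal.ofReal_le_ofReal
  simp only [finrank_euclideanSpace, Fintype.card_fin, NNReal.coe_pow, ← mul_pow]
  gcongr

theorem volume_ball_pos' (x : Eu n) {r : ℝ} (hr : 0 < r) : volume (ball x r) ≠ 0 :=
  (measure_ball_pos _ _ hr).ne'

namespace IsMuckenhoupt

variable {p : ℝ} {C : ℝ≥0} {ν : Measure (Eu n)}

theorem measure_ball_le (h : IsMuckenhoupt p C ν) (hp : 0 < p) {x : Eu n} {r : ℝ} (hr : 0 < r)
    {E : Set (Eu n)} (hE : MeasurableSet E) (hEB : E ⊆ ball x r) {N : ℝ≥0}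
    (hN : volume (ball x r) ≤ N * volume E) :
    ν (ball x r) ≤ (((C * N) ^ p : ℝ≥0) : ℝ≥0∞) * ν E := by
  have h1 := h.lintegral_mul_le x r hr (E.indicator 1)
    ((measurable_one.indicator hE).aemeasurable)
  have e1 : ∫⁻ y in ball x r, E.indicator (1 : Eu n → ℝ≥0∞) y = volume E := by
    rw [lintegral_indicator_one hE, Measure.restrict_apply hE, inter_eq_left.2 hEB]
  have e2 : ∫⁻ y in ball x r, E.indicator (1 : Eu n → ℝ≥0∞) y ^ p ∂ν = ν E := by
    have : (fun y => E.indicator (1 : Eu n → ℝ≥0∞) y ^ p) = E.indicator 1 := by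
      ext y; by_cases hy : y ∈ E <;> simp [hy, hp]
    rw [this, lintegral_indicator_one hE, Measure.restrict_apply hE, inter_eq_left.2 hEB]
  rw [e1, e2] at h1
  have hE0 : volume E ≠ 0 := by
    intro h0
    rw [h0, mul_zero, nonpos_iff_eq_zero] at hN
    exact volume_ball_pos' x hr hN
  have hEt : volume E ≠ ∞ := ((measure_mono hEB).trans_lt measure_ball_lt_top).ne
  have h2 : volume E * ν (ball x r) ^ (1 / p) ≤ volume E * ((C * N : ℝ≥0) * ν E ^ (1 / p)) := by
    refine h1.trans ?_
    calc (C : ℝ≥0∞) * volume (ball x r) * ν E ^ (1 / p)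
        ≤ C * (N * volume E) * ν E ^ (1 / p) := by gcongr
      _ = _ := by push_cast; ring
  have h3 := (ENNReal.mul_le_mul_iff_right hE0 hEt).1 h2
  have h4 := ENNReal.rpow_le_rpow h3 hp.le
  rwa [ENNReal.mul_rpow_of_nonneg _ _ hp.le, ← ENNReal.rpow_mul, ← ENNReal.rpow_mul,
    one_div_mul_cancel hp.ne', ENNReal.rpow_one, ENNReal.rpow_one,
    ← ENNReal.coe_rpow_of_nonneg _ hp.le] at h4

/-- A ball is controlled by any ball of comparable radius contained in it. -/
theorem measure_ball_le_ball (h : IsMuckenhoupt p C ν) (hp : 0 < p) {x y : Eu n} {r s : ℝ}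
    (hs : 0 < s) (hsub : ball y s ⊆ ball x r) (hr : 0 < r) (K : ℝ≥0) (hK : r ≤ K * s) :
    ν (ball x r) ≤ (((C * K ^ n) ^ p : ℝ≥0) : ℝ≥0∞) * ν (ball y s) :=
  h.measure_ball_le hp hr measurableSet_ball hsub (volume_ball_le_mul x y K hs hK)

/-- Doubling. -/
theorem measure_two_mul_le (h : IsMuckenhoupt p C ν) (hp : 0 < p) (x : Eu n) {r : ℝ} (hr : 0 < r) :
    ν (ball x (2 * r)) ≤ (((C * 2 ^ n) ^ p : ℝ≥0) : ℝ≥0∞) * ν (ball x r) :=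
  h.measure_ball_le_ball hp hr (ball_subset_ball (by linarith)) (by linarith) 2 (by simp)

/-- Reverse doubling. -/
theorem exists_measure_le_mul_two (h : IsMuckenhoupt p C ν) (hp : 0 < p) (hn : 1 ≤ n) :
    ∃ θ : ℝ≥0, θ < 1 ∧ ∀ (x : Eu n) (r : ℝ), 0 < r → ν (ball x r) ≤ θ * ν (ball x (2 * r)) := by
  set D : ℝ≥0 := (C * 4 ^ n) ^ p with hD
  refine ⟨D / (1 + D), ?_, fun x r hr => ?_⟩
  · rw [div_lt_one (by positivity)]
    exact lt_one_add D
  let e : Eu n := EuclideanSpace.single ⟨0, hn⟩ 1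
  have he : ‖e‖ = 1 := by simp [e]
  set y : Eu n := x + (3 / 2 * r) • e with hy
  have hxy : dist y x = 3 / 2 * r := by
    rw [hy, dist_self_add_left, norm_smul, he, mul_one, Real.norm_of_nonneg (by positivity)]
  have hsub : ball y (r / 2) ⊆ ball x (2 * r) := ball_subset_ball' (by rw [hxy]; linarith)
  have hdisj : Disjoint (ball x r) (ball y (r / 2)) :=
    ball_disjoint_ball (by rw [dist_comm, hxy]; linarith)
  have h1 : ν (ball x r) + ν (ball y (r / 2)) ≤ ν (ball x (2 * r)) := by
    rw [← measure_union hdisj measurableSet_ball]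
    exact measure_mono (union_subset (ball_subset_ball (by linarith)) hsub)
  have h2 : ν (ball x (2 * r)) ≤ D * ν (ball y (r / 2)) :=
    h.measure_ball_le_ball hp (by linarith) hsub (by linarith) 4 (by norm_num; linarith)
  have h3 : (1 + D : ℝ≥0) * ν (ball x r) ≤ D * ν (ball x (2 * r)) := by
    calc ((1 + D : ℝ≥0) : ℝ≥0∞) * ν (ball x r) = ν (ball x r) + D * ν (ball x r) := by
          push_cast; ring
      _ ≤ D * ν (ball y (r / 2)) + D * ν (ball x r) := by
          gcongr
          exact (measure_mono (ball_subset_ball (by linarith))).trans h2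
      _ ≤ D * ν (ball x (2 * r)) := by rw [← mul_add, add_comm]; gcongr
  rw [ENNReal.coe_div (by positivity), div_eq_mul_inv, mul_right_comm, ← div_eq_mul_inv,
    ENNReal.le_div_iff_mul_le (Or.inl (by simp)) (Or.inl (by simp)), mul_comm]
  exact h3

theorem exists_tsum_rpow_le (h : IsMuckenhoupt p C ν) (hp : 0 < p) (hn : 1 ≤ n) {s : ℝ}
    (hs : 0 < s) : ∃ S : ℝ≥0, ∀ (x : Eu n) (r : ℝ), 0 < r →
      ∑' j : ℕ, ((j + 1 : ℕ) : ℝ≥0∞) * ν (ball x (2 ^ j * r)) ^ (-s) ≤ S * ν (ball x r) ^ (-s) := by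
  obtain ⟨θ, hθ, hle⟩ := h.exists_measure_le_mul_two hp hn
  set ρ : ℝ≥0 := θ ^ s with hρ
  have hρ1 : ρ < 1 := NNReal.rpow_lt_one hθ hs
  have hsum : Summable fun j : ℕ => ((j + 1 : ℕ) : ℝ≥0) * ρ ^ j := by
    rw [← NNReal.summable_coe]
    have h1 := summable_pow_mul_geometric_of_norm_lt_one (R := ℝ) 1 (r := (ρ : ℝ)) (by simpa)
    have h2 := summable_geometric_of_lt_one ρ.coe_nonneg (by exact_mod_cast hρ1)
    refine (h1.add h2).congr fun j => ?_
    push_cast; ring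
  refine ⟨∑' j : ℕ, ((j + 1 : ℕ) : ℝ≥0) * ρ ^ j, fun x r hr => ?_⟩
  have hpow : ∀ j : ℕ, ν (ball x r) ≤ (θ ^ j : ℝ≥0) * ν (ball x (2 ^ j * r)) := by
    intro j
    induction j with
    | zero => simp
    | succ j ih =>
      refine ih.trans ?_
      have := hle x (2 ^ j * r) (by positivity)
      calc ((θ ^ j : ℝ≥0) : ℝ≥0∞) * ν (ball x (2 ^ j * r))
          ≤ (θ ^ j : ℝ≥0) * (θ * ν (ball x (2 * (2 ^ j * r)))) := by gcongr
        _ = _ := by rw [pow_succ, pow_succ]; push_cast; rw [mul_assoc]; congr 4; ring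
  rw [ENNReal.coe_tsum hsum, ← ENNReal.tsum_mul_right]
  refine ENNReal.tsum_le_tsum fun j => ?_
  have hle1 : ν (ball x (2 ^ j * r)) ^ (-s) ≤ ((ρ ^ j : ℝ≥0) : ℝ≥0∞) * ν (ball x r) ^ (-s) := by
    have h1 := ENNReal.rpow_le_rpow (hpow j) hs.le
    rw [ENNReal.mul_rpow_of_nonneg _ _ hs.le, ← ENNReal.coe_rpow_of_nonneg _ hs.le,
      ← NNReal.rpow_natCast_mul, mul_comm (j : ℝ), NNReal.rpow_mul, NNReal.rpow_natCast,
      ← hρ] at h1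
    have p1 := h.pos x (2 ^ j * r) (by positivity)
    have p2 := h.pos x r hr
    rw [ENNReal.rpow_neg, ENNReal.rpow_neg, ← div_eq_mul_inv]
    rw [ENNReal.le_div_iff_mul_le (Or.inl (by simp [p2.ne', hs, (h.lt_top x r).ne, hs.not_gt]))
      (Or.inl (by simp [p2.ne', hs, (h.lt_top x r).ne, hs.not_gt])), mul_comm, ← div_eq_mul_inv]
    exact ENNReal.div_le_of_le_mul h1
  push_cast at hle1 ⊢
  rw [mul_assoc]
  gcongr

end IsMuckenhoupt

theorem withDensity_ball_pos {u : Eu n → ℝ≥0∞} (hu : AEMeasurable u) (hu0 : ∀ᵐ x, u x ≠ 0)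
    (x : Eu n) {r : ℝ} (hr : 0 < r) : 0 < volume.withDensity u (ball x r) := by
  rw [pos_iff_ne_zero]
  intro h
  exact volume_ball_pos' x hr (withDensity_absolutelyContinuous' hu hu0 h)

/-- Hölder's inequality for a pair of dual densities. -/
theorem setLIntegral_mul_le_withDensity {u v : Eu n → ℝ≥0∞} {p q : ℝ} (hpq : p.HolderConjugate q)
    (hu : AEMeasurable u) (hv : AEMeasurable v) (hut : ∀ᵐ x, u x ≠ ∞) (hvt : ∀ᵐ x, v x ≠ ∞)
    (huv : ∀ᵐ x, u x ^ (1 / p) * v x ^ (1 / q) = 1) {S : Set (Eu n)} (hS : MeasurableSet S)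
    {g h : Eu n → ℝ≥0∞} (hg : AEMeasurable g) (hh : AEMeasurable h) :
    ∫⁻ y in S, g y * h y ≤ (∫⁻ y in S, g y ^ p ∂volume.withDensity u) ^ (1 / p) *
      (∫⁻ y in S, h y ^ q ∂volume.withDensity v) ^ (1 / q) := by
  have hp := hpq.pos
  have hq := hpq.symm.pos
  have h1 : ∫⁻ y in S, g y * h y =
      ∫⁻ y in S, ((fun y => g y * u y ^ (1 / p)) * fun y => h y * v y ^ (1 / q)) y := by
    refine lintegral_congr_ae (ae_restrict_of_ae ?_)
    filter_upwards [huv] with y hy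
    rw [Pi.mul_apply, mul_mul_mul_comm, hy, mul_one]
  have key : ∀ {d f : Eu n → ℝ≥0∞} {t : ℝ}, 0 < t → AEMeasurable d → (∀ᵐ x, d x ≠ ∞) →
      ∫⁻ y in S, (f y * d y ^ (1 / t)) ^ t = ∫⁻ y in S, f y ^ t ∂volume.withDensity d := by
    intro d f t ht hd hdt
    rw [setLIntegral_withDensity_eq_setLIntegral_mul_non_measurable₀ _ hd.restrict _
      hS (ae_restrict_of_ae (hdt.mono fun _ => Ne.lt_top))]
    refine lintegral_congr fun y => ?_
    rw [Pi.mul_apply, ENNReal.mul_rpow_of_nonneg _ _ ht.le, ← ENNReal.rpow_mul,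
      one_div_mul_cancel ht.ne', ENNReal.rpow_one, mul_comm]
  rw [h1, ← key hp hu hut, ← key hq hv hvt]
  exact ENNReal.lintegral_mul_le_Lp_mul_Lq _ hpq
    (hg.mul (hu.pow_const _)).restrict (hh.mul (hv.pow_const _)).restrict

/-- A pair of dual densities satisfying the `A_p` condition gives a Muckenhoupt measure. -/
theorem isMuckenhoupt_withDensity {u v : Eu n → ℝ≥0∞} {p q : ℝ} {C : ℝ≥0}
    (hpq : p.HolderConjugate q) (hu : AEMeasurable u) (hv : AEMeasurable v)
    (hu0 : ∀ᵐ x, u x ≠ 0) (hut : ∀ᵐ x, u x ≠ ∞) (hvt : ∀ᵐ x, v x ≠ ∞)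
    (huv : ∀ᵐ x, u x ^ (1 / p) * v x ^ (1 / q) = 1)
    (hfin : ∀ x r, volume.withDensity u (ball x r) < ∞)
    (hC : ∀ x r, 0 < r → volume.withDensity u (ball x r) ^ (1 / p) *
      volume.withDensity v (ball x r) ^ (1 / q) ≤ C * volume (ball x r)) :
    IsMuckenhoupt p C (volume.withDensity u) where
  ac := withDensity_absolutelyContinuous _ _
  pos x r hr := withDensity_ball_pos hu hu0 x hr
  lt_top := hfin
  lintegral_mul_le x r hr g hg := by
    have h2 : ∫⁻ y in ball x r, g y ≤ (∫⁻ y in ball x r, g y ^ p ∂volume.withDensity u) ^ (1 / p) *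
        volume.withDensity v (ball x r) ^ (1 / q) := by
      simpa using setLIntegral_mul_le_withDensity hpq hu hv hut hvt huv measurableSet_ball hg
        (aemeasurable_const (b := (1 : ℝ≥0∞)))
    calc _ ≤ (∫⁻ y in ball x r, g y ^ p ∂volume.withDensity u) ^ (1 / p) *
        volume.withDensity v (ball x r) ^ (1 / q) * volume.withDensity u (ball x r) ^ (1 / p) := by
          gcongr
      _ = (∫⁻ y in ball x r, g y ^ p ∂volume.withDensity u) ^ (1 / p) *
        (volume.withDensity u (ball x r) ^ (1 / p) * volume.withDensity v (ball x r) ^ (1 / q)) := by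
          ring
      _ ≤ (∫⁻ y in ball x r, g y ^ p ∂volume.withDensity u) ^ (1 / p) *
        (C * volume (ball x r)) := by gcongr 1; exact hC x r hr
      _ = _ := by ring

theorem IsWeight.aemeasurable {w : Eu n → ℝ} (hw : IsWeight w) :
    AEMeasurable (fun x => ENNReal.ofReal (w x)) :=
  hw.locallyIntegrable.aestronglyMeasurable.aemeasurable.ennreal_ofReal

theorem _root_.MeasureTheory.LocallyIntegrable.setLIntegral_enorm_ball_lt_top {E : Type*}
    [NormedAddCommGroup E] {f : Eu n → E} (hf : LocallyIntegrable f volume) (x : Eu n) (r : ℝ) :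
    ∫⁻ y in ball x r, ‖f y‖ₑ < ∞ :=
  ((hf.integrableOn_isCompact (isCompact_closedBall x r)).mono_set ball_subset_closedBall).2

theorem IsWeight.wMeas_ball_lt_top {w : Eu n → ℝ} (hw : IsWeight w) (x : Eu n) (r : ℝ) :
    wMeas w (ball x r) < ∞ := by
  rw [wMeas, withDensity_apply _ measurableSet_ball]
  exact (lintegral_mono fun y => ENNReal.ofReal_le_ofReal_iff'.2 (Or.inl (le_abs_self (w y)))).trans_lt
    (by simpa [Real.enorm_eq_ofReal_abs] using
      hw.locallyIntegrable.setLIntegral_enorm_ball_lt_top x r)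

theorem IsWeight.volume_absolutelyContinuous {w : Eu n → ℝ} (hw : IsWeight w) :
    volume ≪ wMeas w :=
  withDensity_absolutelyContinuous' hw.aemeasurable (hw.pos.mono fun x hx => by simpa using hx)

/-- The density `w^{1-p'}` of the dual weight. -/
def dualDensity (p : ℝ) (w : Eu n → ℝ) (x : Eu n) : ℝ≥0∞ := ENNReal.ofReal (w x) ^ (1 - p / (p - 1))

theorem IsAp.exists_isMuckenhoupt {p : ℝ} (hp : 1 < p) {w : Eu n → ℝ} (hw : IsAp p w) :
    ∃ C : ℝ≥0, IsMuckenhoupt p C (wMeas w) ∧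
      IsMuckenhoupt (p / (p - 1)) C (volume.withDensity (dualDensity p w)) ∧
      (∀ x r, 0 < r → wMeas w (ball x r) ^ (1 / p) *
        volume.withDensity (dualDensity p w) (ball x r) ^ (1 / (p / (p - 1))) ≤
          C * volume (ball x r)) ∧
      ∀ x r, ∀ g h : Eu n → ℝ≥0∞, AEMeasurable g → AEMeasurable h →
        ∫⁻ y in ball x r, g y * h y ≤ (∫⁻ y in ball x r, g y ^ p ∂wMeas w) ^ (1 / p) *
          (∫⁻ y in ball x r, h y ^ (p / (p - 1)) ∂volume.withDensity (dualDensity p w)) ^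
            (1 / (p / (p - 1))) := by
  set u : Eu n → ℝ≥0∞ := fun x => ENNReal.ofReal (w x) with hu_def
  set v := dualDensity p w with hv_def
  set q := p / (p - 1) with hq_def
  have hp0 : 0 < p := by linarith
  have hp1 : 0 < p - 1 := by linarith
  have hpq : p.HolderConjugate q := Real.HolderConjugate.conjExponent hp
  have hq0 := hpq.symm.pos
  have hu : AEMeasurable u := hw.isWeight.aemeasurable
  have hv : AEMeasurable v := hu.pow_const _
  have hut : ∀ x, u x ≠ ∞ := fun x => by simp [hu_def]
  have hu0 : ∀ᵐ x, u x ≠ 0 := hw.isWeight.pos.mono fun x hx => by simpa [hu_def] using hx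
  have hv0 : ∀ᵐ x, v x ≠ 0 := hu0.mono fun x hx => by
    simp only [hv_def, dualDensity]
    exact (ENNReal.rpow_pos (pos_iff_ne_zero.2 hx) (hut x)).ne'
  have hvt : ∀ᵐ x, v x ≠ ∞ := hu0.mono fun x hx => by
    simp only [hv_def, dualDensity]
    exact ENNReal.rpow_ne_top_of_ne_zero hx (hut x)
  have huv : ∀ᵐ x, u x ^ (1 / p) * v x ^ (1 / q) = 1 := hu0.mono fun x hx => by
    simp only [hv_def, dualDensity]
    rw [← ENNReal.rpow_mul, ← ENNReal.rpow_add _ _ hx (hut x)]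
    have : 1 / p + (1 - p / (p - 1)) * (1 / q) = 0 := by rw [hq_def]; field_simp; ring
    rw [this, ENNReal.rpow_zero]
  have hUfin : ∀ x r, volume.withDensity u (ball x r) < ∞ := hw.isWeight.wMeas_ball_lt_top
  have hK : ∀ x r, 0 < r → (volume.withDensity u (ball x r) / volume (ball x r)) *
      (volume.withDensity v (ball x r) / volume (ball x r)) ^ (p - 1) ≤ apConst p w := by
    intro x r hr
    rw [withDensity_apply _ measurableSet_ball, withDensity_apply _ measurableSet_ball,
      ← setLAverage_eq, ← setLAverage_eq]
    exact le_iSup_of_le x (le_iSup_of_le r (le_iSup_of_le hr le_rfl))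
  have hVfin : ∀ x r, volume.withDensity v (ball x r) < ∞ := by
    intro x r
    rcases le_or_gt r 0 with hr | hr
    · simp [ball_eq_empty.2 hr]
    by_contra h
    have h' : volume.withDensity v (ball x r) = ∞ := by simpa using h
    have h1 := hK x r hr
    rw [h', ENNReal.top_div_of_ne_top measure_ball_lt_top.ne, ENNReal.top_rpow_of_pos hp1,
      ENNReal.mul_top] at h1
    · exact hw.apConst_lt_top.not_ge h1
    · exact (ENNReal.div_pos (withDensity_ball_pos hu hu0 x hr).ne' measure_ball_lt_top.ne).ne'
  set C : ℝ≥0 := (apConst p w ^ (1 / p)).toNNReal with hC_def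
  have hCc : (C : ℝ≥0∞) = apConst p w ^ (1 / p) :=
    ENNReal.coe_toNNReal (ENNReal.rpow_ne_top_of_nonneg (by positivity) hw.apConst_lt_top.ne)
  have hC : ∀ x r, 0 < r → volume.withDensity u (ball x r) ^ (1 / p) *
      volume.withDensity v (ball x r) ^ (1 / q) ≤ C * volume (ball x r) := by
    intro x r hr
    have hB0 := volume_ball_pos' x hr
    have hBt : volume (ball x r) ≠ ∞ := measure_ball_lt_top.ne
    have h1 := ENNReal.rpow_le_rpow (hK x r hr) (z := 1 / p) (by positivity)
    rw [ENNReal.mul_rpow_of_nonneg _ _ (by positivity), ← ENNReal.rpow_mul, ← hCc,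
      ENNReal.div_rpow_of_nonneg _ _ (by positivity),
      ENNReal.div_rpow_of_nonneg _ _ (by positivity)] at h1
    have e1 : (p - 1) * (1 / p) = 1 / q := by rw [hq_def]; field_simp
    rw [e1] at h1
    have e2 : volume (ball x r) = volume (ball x r) ^ (1 / p) * volume (ball x r) ^ (1 / q) := by
      rw [← ENNReal.rpow_add _ _ hB0 hBt, hpq.one_div_add_one_div, div_one, ENNReal.rpow_one]
    rw [e2]
    set b := volume (ball x r)
    have hb1 : b ^ (1 / p) ≠ 0 := (ENNReal.rpow_pos (pos_iff_ne_zero.2 hB0) hBt).ne'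
    have hb2 : b ^ (1 / q) ≠ 0 := (ENNReal.rpow_pos (pos_iff_ne_zero.2 hB0) hBt).ne'
    have hb3 : b ^ (1 / p) ≠ ∞ := ENNReal.rpow_ne_top_of_ne_zero hB0 hBt
    have hb4 : b ^ (1 / q) ≠ ∞ := ENNReal.rpow_ne_top_of_ne_zero hB0 hBt
    calc _ = (volume.withDensity u (ball x r) ^ (1 / p) / b ^ (1 / p) * b ^ (1 / p)) *
        (volume.withDensity v (ball x r) ^ (1 / q) / b ^ (1 / q) * b ^ (1 / q)) := by
          rw [ENNReal.div_mul_cancel hb1 hb3, ENNReal.div_mul_cancel hb2 hb4]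
      _ = volume.withDensity u (ball x r) ^ (1 / p) / b ^ (1 / p) *
        (volume.withDensity v (ball x r) ^ (1 / q) / b ^ (1 / q)) * (b ^ (1 / p) * b ^ (1 / q)) := by
          ring
      _ ≤ _ := by gcongr
  exact ⟨C, isMuckenhoupt_withDensity hpq hu hv hu0 (ae_of_all _ hut) hvt huv hUfin hC,
    isMuckenhoupt_withDensity hpq.symm hv hu hv0 hvt (ae_of_all _ hut)
      (huv.mono fun x hx => by rwa [mul_comm]) hVfin
      fun x r hr => by rw [mul_comm]; exact hC x r hr, hC, fun x r g h hg hh =>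
    setLIntegral_mul_le_withDensity hpq hu hv (ae_of_all _ hut) hvt huv measurableSet_ball hg hh⟩

theorem IsA1.exists_isMuckenhoupt {w : Eu n → ℝ} (hw : IsA1 w) :
    ∃ C : ℝ≥0, IsMuckenhoupt 1 C (wMeas w) := by
  obtain ⟨C, hC⟩ := hw.average_le
  refine ⟨C, withDensity_absolutelyContinuous _ _, fun x r hr => withDensity_ball_pos
    hw.isWeight.aemeasurable (hw.isWeight.pos.mono fun x hx => by simpa using hx) x hr,
    hw.isWeight.wMeas_ball_lt_top, fun x r hr g hg => ?_⟩
  have hB0 := volume_ball_pos' x hr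
  have hBt : volume (ball x r) ≠ ∞ := measure_ball_lt_top.ne
  simp only [div_one, ENNReal.rpow_one]
  have h1 := hC x r hr
  rw [setLAverage_eq, ← withDensity_apply _ measurableSet_ball, ← wMeas] at h1
  have hfin : wMeas w (ball x r) / volume (ball x r) ≠ ∞ :=
    ENNReal.div_ne_top (hw.isWeight.wMeas_ball_lt_top x r).ne hB0
  calc _ = (∫⁻ y in ball x r, g y) * (wMeas w (ball x r) / volume (ball x r)) *
        volume (ball x r) := by rw [mul_assoc, ENNReal.div_mul_cancel hB0 hBt]
    _ = (∫⁻ y in ball x r, g y * (wMeas w (ball x r) / volume (ball x r))) *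
        volume (ball x r) := by rw [lintegral_mul_const' _ _ hfin]
    _ ≤ (∫⁻ y in ball x r, C * (ENNReal.ofReal (w y) * g y)) * volume (ball x r) := by
        gcongr 1
        refine lintegral_mono_ae (h1.mono fun y hy => ?_)
        calc _ ≤ g y * (C * ENNReal.ofReal (w y)) := by gcongr
          _ = _ := by ring
    _ = C * (∫⁻ y in ball x r, g y ∂wMeas w) * volume (ball x r) := by
        rw [lintegral_const_mul' _ _ ENNReal.coe_ne_top, wMeas,
          setLIntegral_withDensity_eq_setLIntegral_mul_non_measurable₀ _
            hw.isWeight.aemeasurable.restrict _ measurableSet_ball (by simp)]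
        rfl
    _ = _ := by ring

/-- Dyadic annuli decomposition of the integral of `|x - y|⁻ⁿ g(y)` away from a ball. -/
theorem exists_lintegral_czKernel_le (n : ℕ) : ∃ c : ℝ≥0, ∀ (x₀ : Eu n) (r : ℝ), 0 < r →
    ∀ x ∈ ball x₀ r, ∀ g : Eu n → ℝ≥0∞,
      ∫⁻ y in (ball x₀ (2 * r))ᶜ, czKernel x y * g y ≤
        c * ∑' i : ℕ, (volume (ball x₀ (2 ^ i * (4 * r))))⁻¹ *
          ∫⁻ y in ball x₀ (2 ^ i * (4 * r)), g y := by
  set v := volume (ball (0 : Eu n) 1) with hv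
  have hvt : v ≠ ∞ := measure_ball_lt_top.ne
  refine ⟨(4 ^ n * v).toNNReal, fun x₀ r hr x hx g => ?_⟩
  rw [ENNReal.coe_toNNReal (ENNReal.mul_ne_top (by simp) hvt)]
  set A : ℕ → Set (Eu n) := fun i => ball x₀ (2 ^ i * (4 * r)) \ ball x₀ (2 ^ i * (2 * r)) with hA
  have hcov : (ball x₀ (2 * r))ᶜ ⊆ ⋃ i, A i := by
    intro y hy
    simp only [mem_compl_iff, mem_ball, not_lt] at hy
    obtain ⟨i, hi1, hi2⟩ := exists_nat_pow_near (x := dist y x₀ / (2 * r)) (y := 2)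
      (by rw [le_div_iff₀ (by positivity)]; linarith) (by norm_num)
    rw [le_div_iff₀ (by positivity)] at hi1
    rw [div_lt_iff₀ (by positivity)] at hi2
    refine mem_iUnion.2 ⟨i, ?_, ?_⟩
    · rw [mem_ball]; refine hi2.trans_eq ?_; ring
    · simpa using hi1
  refine (lintegral_mono_set hcov).trans ((lintegral_iUnion_le _ _).trans ?_)
  rw [← ENNReal.tsum_mul_left]
  refine ENNReal.tsum_le_tsum fun i => ?_
  set R := 2 ^ i * (4 * r) with hR
  have hRpos : 0 < R := by positivity
  have hpt : ∀ y ∈ A i, czKernel x y * g y ≤ (4 ^ n * v * (volume (ball x₀ R))⁻¹) * g y := by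
    intro y hy
    gcongr
    have h1 : 2 ^ i * (2 * r) ≤ dist y x₀ := by simpa [A] using hy.2
    have h2 : dist x x₀ < r := hx
    have h3 : dist y x₀ ≤ dist y x + dist x x₀ := dist_triangle _ _ _
    have h4 : r ≤ 2 ^ i * r := le_mul_of_one_le_left hr.le (one_le_pow₀ (by norm_num))
    have h5 : R ≤ ((4 * ‖x - y‖₊ : ℝ≥0) : ℝ) * 1 := by
      push_cast
      rw [← dist_eq_norm, dist_comm x y, mul_one, hR]
      linarith
    have h6 := volume_ball_le_mul x₀ (0 : Eu n) (4 * ‖x - y‖₊) one_pos h5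
    have ha0 : 4 ^ n * v ≠ 0 := mul_ne_zero (by simp) (volume_ball_pos' 0 one_pos)
    have hat : 4 ^ n * v ≠ ∞ := ENNReal.mul_ne_top (by simp) hvt
    calc czKernel x y = (4 ^ n * v) * (4 ^ n * v * ‖x - y‖ₑ ^ n)⁻¹ := by
          rw [ENNReal.mul_inv (Or.inl ha0) (Or.inl hat), ← mul_assoc,
            ENNReal.mul_inv_cancel ha0 hat, one_mul, czKernel]
      _ ≤ _ := by
          gcongr
          refine h6.trans_eq ?_
          rw [mul_pow]; push_cast; rw [enorm_eq_nnnorm]; ring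
  calc ∫⁻ y in A i, czKernel x y * g y
      ≤ ∫⁻ y in A i, (4 ^ n * v * (volume (ball x₀ R))⁻¹) * g y :=
        setLIntegral_mono' (measurableSet_ball.diff measurableSet_ball) hpt
    _ ≤ ∫⁻ y in ball x₀ R, (4 ^ n * v * (volume (ball x₀ R))⁻¹) * g y :=
        lintegral_mono_set sdiff_subset
    _ = _ := by
      rw [lintegral_const_mul', mul_assoc]
      exact ENNReal.mul_ne_top (ENNReal.mul_ne_top (by simp) hvt)
        (ENNReal.inv_ne_top.2 (volume_ball_pos' x₀ hRpos))

section Morrey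

variable {p κ : ℝ} {w : Eu n → ℝ} {C : ℝ≥0}

theorem eLpNorm_ball_le_morreyNorm (h : IsMuckenhoupt p C (wMeas w)) (f : Eu n → 𝕜) (x : Eu n)
    {r : ℝ} (hr : 0 < r) :
    eLpNorm f (ENNReal.ofReal p) ((wMeas w).restrict (ball x r)) ≤
      morreyNorm p κ w f * wMeas w (ball x r) ^ (κ / p) := by
  have h1 : wMeas w (ball x r) ^ (-κ / p) *
      eLpNorm f (ENNReal.ofReal p) ((wMeas w).restrict (ball x r)) ≤ morreyNorm p κ w f :=
    le_iSup_of_le x (le_iSup_of_le r (le_iSup_of_le hr le_rfl))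
  refine le_trans (le_of_eq ?_) (mul_le_mul_left h1 _)
  rw [mul_right_comm, ← ENNReal.rpow_add _ _ (h.pos x r hr).ne' (h.lt_top x r).ne]
  simp [neg_div]

theorem eLpNorm_eq_lintegral (hp : 0 < p) (f : Eu n → 𝕜) (ν : Measure (Eu n)) :
    eLpNorm f (ENNReal.ofReal p) ν = (∫⁻ y, ‖f y‖ₑ ^ p ∂ν) ^ (1 / p) := by
  rw [eLpNorm_eq_lintegral_rpow_enorm_toReal (by simpa using hp) ENNReal.ofReal_ne_top,
    ENNReal.toReal_ofReal hp.le]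

/-- Averages of a Morrey function over balls. -/
theorem laverage_le_morreyNorm (h : IsMuckenhoupt p C (wMeas w)) (hp : 0 < p) {f : Eu n → 𝕜}
    (hf : AEStronglyMeasurable f volume) (x : Eu n) {r : ℝ} (hr : 0 < r) :
    (volume (ball x r))⁻¹ * ∫⁻ y in ball x r, ‖f y‖ₑ ≤
      C * morreyNorm p κ w f * wMeas w (ball x r) ^ (-((1 - κ) / p)) := by
  have h1 := h.lintegral_mul_le x r hr (fun y => ‖f y‖ₑ) hf.enorm
  rw [← eLpNorm_eq_lintegral hp] at h1
  have h2 := h1.trans (mul_le_mul_right (eLpNorm_ball_le_morreyNorm (κ := κ) h f x hr) _)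
  set ν := wMeas w (ball x r)
  have hν0 : ν ≠ 0 := (h.pos x r hr).ne'
  have hνt : ν ≠ ∞ := (h.lt_top x r).ne
  set I := ∫⁻ y in ball x r, ‖f y‖ₑ
  have hV0 := volume_ball_pos' x hr
  have hVt : volume (ball x r) ≠ ∞ := measure_ball_lt_top.ne
  calc (volume (ball x r))⁻¹ * I = (volume (ball x r))⁻¹ * (I * ν ^ (1 / p)) * ν ^ (-(1 / p)) := by
        rw [mul_assoc, mul_assoc, ← ENNReal.rpow_add _ _ hν0 hνt]; simp
    _ ≤ (volume (ball x r))⁻¹ * (C * volume (ball x r) * (morreyNorm p κ w f * ν ^ (κ / p))) *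
          ν ^ (-(1 / p)) := by gcongr
    _ = ((volume (ball x r))⁻¹ * volume (ball x r)) * (C * morreyNorm p κ w f) *
          (ν ^ (κ / p) * ν ^ (-(1 / p))) := by ring
    _ = _ := by
        rw [ENNReal.inv_mul_cancel hV0 hVt, one_mul, ← ENNReal.rpow_add _ _ hν0 hνt]
        congr 2; ring

/-- Summation of the averages over dyadic dilates of a ball. -/
theorem IsMuckenhoupt.exists_tsum_le {ν : Measure (Eu n)} (h : IsMuckenhoupt p C ν) (hp : 0 < p)
    (hn : 1 ≤ n) (hκ : κ < 1) : ∃ S : ℝ≥0, ∀ (x : Eu n) (r : ℝ), 0 < r → ∀ (A : ℝ≥0∞) (a : ℕ → ℝ≥0∞),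
      (∀ i, a i ≤ A * ((i + 1 : ℕ) * ν (ball x (2 ^ i * (4 * r))) ^ (-((1 - κ) / p)))) →
      ∑' i, a i ≤ A * (S * ν (ball x r) ^ (-((1 - κ) / p))) := by
  have hs : 0 < (1 - κ) / p := div_pos (by linarith) hp
  obtain ⟨S, hS⟩ := h.exists_tsum_rpow_le hp hn hs
  refine ⟨S, fun x r hr A a ha => (ENNReal.tsum_le_tsum ha).trans ?_⟩
  rw [ENNReal.tsum_mul_left]
  gcongr
  refine (hS x (4 * r) (by positivity)).trans ?_
  rw [ENNReal.rpow_neg, ENNReal.rpow_neg]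
  gcongr
  linarith

end Morrey

/-- For every ball `B`, the part of the size estimate that comes from outside `2B` has on `B` an
everywhere finite majorant with the right weighted norm, with a constant independent of `f`. -/
def HasMajorant (K : Eu n → Eu n → ℝ≥0∞) (p κ : ℝ) (w : Eu n → ℝ) (𝕜 : Type*) [RCLike 𝕜] : Prop :=
  ∃ C : ℝ≥0, ∀ f : Eu n → 𝕜, MemMorrey p κ w f → ∀ (x₀ : Eu n) (r : ℝ), 0 < r →
    ∃ h : Eu n → ℝ≥0∞, (∀ x, h x < ∞) ∧ AEMeasurable h volume ∧
      (∀ x ∈ ball x₀ r, ∫⁻ y in (ball x₀ (2 * r))ᶜ, K x y * ‖f y‖ₑ ≤ h x) ∧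
      (∫⁻ x in ball x₀ r, h x ^ p ∂wMeas w) ^ (1 / p) ≤
        C * morreyNorm p κ w f * wMeas w (ball x₀ r) ^ (κ / p)

theorem hasMajorant_czKernel {p κ : ℝ} {w : Eu n → ℝ} {C : ℝ≥0}
    (hw : IsMuckenhoupt p C (wMeas w)) (hp : 0 < p) (hn : 1 ≤ n) (hκ : κ < 1) :
    HasMajorant czKernel p κ w 𝕜 := by
  obtain ⟨c, hc⟩ := exists_lintegral_czKernel_le n
  obtain ⟨S, hS⟩ := hw.exists_tsum_le hp hn hκ
  refine ⟨c * C * S, fun f hf x₀ r hr => ?_⟩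
  set M := morreyNorm p κ w f
  set ν := wMeas w (ball x₀ r) with hν
  have hν0 : ν ≠ 0 := (hw.pos x₀ r hr).ne'
  have hνt : ν ≠ ∞ := (hw.lt_top x₀ r).ne
  have hMt : M ≠ ∞ := hf.norm_lt_top.ne
  refine ⟨fun _ => c * (C * M * (S * ν ^ (-((1 - κ) / p)))), fun _ => ?_, aemeasurable_const,
    fun x hx => (hc x₀ r hr x hx fun y => ‖f y‖ₑ).trans ?_, ?_⟩
  · have : ν ^ (-((1 - κ) / p)) ≠ ∞ := ENNReal.rpow_ne_top_of_ne_zero hν0 hνt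
    exact (ENNReal.mul_ne_top (by simp) (ENNReal.mul_ne_top (ENNReal.mul_ne_top (by simp) hMt)
      (ENNReal.mul_ne_top (by simp) this))).lt_top
  · refine mul_le_mul_right ?_ _
    refine hS x₀ r hr _ _ fun i => ?_
    refine (laverage_le_morreyNorm (κ := κ) hw hp hf.locallyIntegrable.aestronglyMeasurable x₀
      (by positivity)).trans ?_
    refine mul_le_mul_right (le_mul_of_one_le_left zero_le ?_) _
    exact_mod_cast Nat.le_add_left 1 i
  · rw [setLIntegral_const, ENNReal.mul_rpow_of_nonneg _ _ (by positivity), ← ENNReal.rpow_mul,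
      mul_one_div_cancel hp.ne', ENNReal.rpow_one, ← hν]
    refine le_of_eq ?_
    calc _ = (c * C * S : ℝ≥0∞) * M * (ν ^ (-((1 - κ) / p)) * ν ^ (1 / p)) := by ring
      _ = _ := by
        rw [← ENNReal.rpow_add _ _ hν0 hνt]
        push_cast; congr 2; ring

theorem tendsto_setLIntegral_compl_ball {μ : Measure (Eu n)} {g : Eu n → ℝ≥0∞} {k₀ : ℕ}
    (h : ∫⁻ y in (ball (0 : Eu n) k₀)ᶜ, g y ∂μ ≠ ∞) :
    Tendsto (fun k : ℕ => ∫⁻ y in (ball (0 : Eu n) k)ᶜ, g y ∂μ) atTop (𝓝 0) := by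
  have hm : ∀ k : ℕ, MeasurableSet (ball (0 : Eu n) k)ᶜ := fun k => measurableSet_ball.compl
  have h1 := tendsto_measure_iInter_atTop (μ := μ.withDensity g)
    (s := fun k : ℕ => (ball (0 : Eu n) k)ᶜ) (fun k => (hm k).nullMeasurableSet)
    (fun i j hij => compl_subset_compl.2 (ball_subset_ball (by exact_mod_cast hij)))
    ⟨k₀, by rwa [withDensity_apply _ (hm k₀)]⟩
  have h2 : ⋂ k : ℕ, (ball (0 : Eu n) k)ᶜ = ∅ := by
    rw [← compl_iUnion, iUnion_ball_nat, compl_univ]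
  rw [h2, measure_empty] at h1
  refine h1.congr fun k => ?_
  simp [withDensity_apply _ (hm k)]

theorem lintegral_mul_enorm_indicator_le (k : Eu n → ℝ≥0∞) {f g : Eu n → 𝕜} {S : Set (Eu n)}
    (hS : MeasurableSet S) (hle : ∀ y, ‖g y‖ₑ ≤ ‖f y‖ₑ) (hg : ∀ y ∉ S, g y = 0) :
    ∫⁻ y, k y * ‖g y‖ₑ ≤ ∫⁻ y in S, k y * ‖f y‖ₑ := by
  rw [← lintegral_indicator hS]
  refine lintegral_mono fun y => ?_
  by_cases hy : y ∈ S
  · simp only [indicator_of_mem hy]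
    exact mul_le_mul_right (hle y) _
  · simp [hg y hy]

theorem IsSublinearOn.abs_norm_sub_norm_le {D : Submodule 𝕜 (Eu n → 𝕜)}
    {T : (Eu n → 𝕜) → Eu n → 𝕜} (hT : IsSublinearOn D T) {f g : Eu n → 𝕜} (hf : f ∈ D)
    (hg : g ∈ D) : ∀ᵐ x, |‖T f x‖ - ‖T g x‖| ≤ ‖T (f - g) x‖ := by
  have hfg := D.sub_mem hf hg
  filter_upwards [hT.add_le g hg _ hfg, hT.add_le f hf _ (D.smul_mem (-1 : 𝕜) hfg),
    hT.smul_eq (-1) _ hfg] with x h1 h2 h3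
  have e1 : g + (f - g) = f := by abel
  have e2 : f + (-1 : 𝕜) • (f - g) = g := by rw [neg_one_smul]; abel
  rw [e1] at h1
  rw [e2, h3, norm_neg, norm_one, one_mul] at h2
  rw [abs_le]
  constructor <;> linarith

section Weak

theorem le_weakNorm (p : ℝ) (μ : Measure (Eu n)) (f : Eu n → 𝕜) (t : ℝ≥0) :
    (t : ℝ≥0∞) * μ {x | (t : ℝ≥0∞) < ‖f x‖ₑ} ^ (1 / p) ≤ weakNorm p μ f :=
  le_iSup (fun t : ℝ≥0 => (t : ℝ≥0∞) * μ {x | (t : ℝ≥0∞) < ‖f x‖ₑ} ^ (1 / p)) t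

theorem weakNorm_le_eLpNorm {p : ℝ} (hp : 0 < p) {μ : Measure (Eu n)} {f : Eu n → 𝕜}
    (hf : AEStronglyMeasurable f μ) : weakNorm p μ f ≤ eLpNorm f (ENNReal.ofReal p) μ := by
  refine iSup_le fun t => ?_
  have h := mul_meas_ge_le_pow_eLpNorm' μ (p := ENNReal.ofReal p) (by simpa using hp)
    ENNReal.ofReal_ne_top hf t
  rw [ENNReal.toReal_ofReal hp.le] at h
  have h1 := ENNReal.rpow_le_rpow h (z := 1 / p) (by positivity)
  rw [ENNReal.mul_rpow_of_nonneg _ _ (by positivity), ← ENNReal.rpow_mul, ← ENNReal.rpow_mul,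
    mul_one_div_cancel hp.ne', ENNReal.rpow_one, ENNReal.rpow_one] at h1
  refine le_trans ?_ h1
  gcongr with x
  exact le_of_lt

theorem tendstoInMeasure_of_weakNorm {p : ℝ} (hp : 0 < p) {μ : Measure (Eu n)}
    {u : ℕ → Eu n → 𝕜} (h : Tendsto (fun k => weakNorm p μ (u k)) atTop (𝓝 0)) :
    TendstoInMeasure μ u atTop (fun _ => (0 : 𝕜)) := by
  intro ε hε
  rcases eq_or_ne ε ∞ with rfl | hεt
  · simp [edist_eq_enorm_sub]
  obtain ⟨t, ht0, htε⟩ := ENNReal.lt_iff_exists_nnreal_btwn.1 hε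
  have ht0' : (t : ℝ≥0∞) ≠ 0 := ht0.ne'
  have h1 : Tendsto (fun k => ((t : ℝ≥0∞)⁻¹ * weakNorm p μ (u k)) ^ p) atTop (𝓝 0) := by
    have h2 := ENNReal.Tendsto.const_mul (a := (t : ℝ≥0∞)⁻¹) h (Or.inr (by simpa using ht0'))
    rw [mul_zero] at h2
    have h3 := h2.ennrpow_const p
    rwa [ENNReal.zero_rpow_of_pos hp] at h3
  refine tendsto_of_tendsto_of_tendsto_of_le_of_le tendsto_const_nhds h1 (fun _ => zero_le)
    fun k => ?_
  have h2 := le_weakNorm p μ (u k) t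
  have h3 : μ {x | (t : ℝ≥0∞) < ‖u k x‖ₑ} ^ (1 / p) ≤ (t : ℝ≥0∞)⁻¹ * weakNorm p μ (u k) := by
    rw [mul_comm, ← div_eq_mul_inv, ENNReal.le_div_iff_mul_le (Or.inl ht0') (Or.inl (by simp)),
      mul_comm]
    exact h2
  have h4 := ENNReal.rpow_le_rpow h3 hp.le
  rw [← ENNReal.rpow_mul, one_div_mul_cancel hp.ne', ENNReal.rpow_one] at h4
  refine (measure_mono fun x hx => ?_).trans h4
  simp only [mem_ofPred_eq, edist_zero_right] at hx ⊢
  exact htε.trans_le hx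

end Weak

section Value

variable {K : Eu n → Eu n → ℝ≥0∞} {p κ : ℝ} {w : Eu n → ℝ} {C : ℝ≥0}
  {D : Submodule 𝕜 (Eu n → 𝕜)} {T : (Eu n → 𝕜) → Eu n → 𝕜}

theorem MemMorrey.memLp_indicator_ball (hw : IsMuckenhoupt p C (wMeas w)) (hp : 0 < p)
    (hκ : 0 ≤ κ) {f : Eu n → 𝕜} (hf : MemMorrey p κ w f) (x : Eu n) (r : ℝ) :
    MemLp ((ball x r).indicator f) (ENNReal.ofReal p) (wMeas w) := by
  rcases le_or_gt r 0 with hr | hr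
  · simp [ball_eq_empty.2 hr]
  rw [memLp_indicator_iff_restrict measurableSet_ball]
  refine ⟨(hf.locallyIntegrable.aestronglyMeasurable.mono_ac hw.ac).restrict,
    (eLpNorm_ball_le_morreyNorm (κ := κ) hw f x hr).trans_lt ?_⟩
  exact ENNReal.mul_lt_top hf.norm_lt_top
    (ENNReal.rpow_lt_top_of_nonneg (by positivity) (hw.lt_top x r).ne)

theorem HasMajorant.tendsto_tail (hK : HasMajorant K p κ w 𝕜) {f : Eu n → 𝕜}
    (hf : MemMorrey p κ w f) (x : Eu n) :
    Tendsto (fun k : ℕ => ∫⁻ y in (ball (0 : Eu n) k)ᶜ, K x y * ‖f y‖ₑ) atTop (𝓝 0) := by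
  obtain ⟨C, hC⟩ := hK
  obtain ⟨N, hN⟩ := exists_nat_gt ‖x‖
  have hN0 : (0 : ℝ) < N := (norm_nonneg x).trans_lt hN
  obtain ⟨h, hfin, -, hle, -⟩ := hC f hf 0 N hN0
  refine tendsto_setLIntegral_compl_ball (k₀ := 2 * N) ?_
  have h1 := ((hle x (by simpa using hN)).trans_lt (hfin x)).ne
  simpa using h1

/-- The size condition applied to a truncation of `f` away from a ball. -/
theorem enorm_apply_sub_indicator_le {c : ℝ≥0}
    (hc : ∀ f ∈ D, MemLp f 1 volume → HasCompactSupport f → SizeEstimate K T c f)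
    {f : Eu n → 𝕜} (hf : LocallyIntegrable f volume) (hD : ∀ x r, (ball x r).indicator f ∈ D)
    {a : Eu n} {s : ℝ} {k : ℕ} (hsub : ball a s ⊆ ball 0 k) :
    ∀ᵐ x, x ∈ ball a s →
      ‖T ((ball (0 : Eu n) k).indicator f - (ball a s).indicator f) x‖ₑ ≤
        c * ∫⁻ y in (ball a s)ᶜ, K x y * ‖f y‖ₑ := by
  set g := (ball (0 : Eu n) k).indicator f - (ball a s).indicator f with hg
  have hint : ∀ x r, Integrable ((ball x r).indicator f) volume := fun x r => by
    rw [integrable_indicator_iff measurableSet_ball]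
    exact (hf.integrableOn_isCompact (isCompact_closedBall x r)).mono_set ball_subset_closedBall
  have hg0 : ∀ y ∈ ball a s, g y = 0 := fun y hy => by
    simp [hg, hy, hsub hy]
  have hg1 : ∀ y ∉ ball (0 : Eu n) k, g y = 0 := fun y hy => by
    have : y ∉ ball a s := fun h => hy (hsub h)
    rw [hg, Pi.sub_apply, indicator_of_notMem hy, indicator_of_notMem this, sub_zero]
  have hle : ∀ y, ‖g y‖ₑ ≤ ‖f y‖ₑ := fun y => by
    by_cases h1 : y ∈ ball a s
    · simp [hg0 y h1]
    by_cases h2 : y ∈ ball (0 : Eu n) k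
    · rw [hg, Pi.sub_apply, indicator_of_mem h2, indicator_of_notMem h1, sub_zero]
    · simp [hg1 y h2]
  have hcs : HasCompactSupport g := by
    refine HasCompactSupport.of_support_subset_isCompact (isCompact_closedBall (0 : Eu n) k) ?_
    intro y hy
    by_contra h
    exact hy (hg1 y fun h' => h (ball_subset_closedBall h'))
  have hts : tsupport g ⊆ (ball a s)ᶜ :=
    closure_minimal (fun y hy h => hy (hg0 y h)) isOpen_ball.isClosed_compl
  filter_upwards [hc g (D.sub_mem (hD _ _) (hD _ _))
    (memLp_one_iff_integrable.2 ((hint _ _).sub (hint _ _))) hcs] with x hx hxa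
  refine (hx fun h => hts h hxa).trans (mul_le_mul_right ?_ _)
  exact lintegral_mul_enorm_indicator_le _ measurableSet_ball.compl hle
    fun y hy => hg0 y (by simpa using hy)

theorem exists_tendsto_norm (hT : IsSublinearOn D T) (hs : SizeCondition K D T)
    (hK : HasMajorant K p κ w 𝕜) {f : Eu n → 𝕜} (hf : MemMorrey p κ w f)
    (hD : ∀ x r, (ball x r).indicator f ∈ D) :
    ∀ᵐ x, ∃ L : ℝ, Tendsto (fun k : ℕ => ‖T ((ball (0 : Eu n) k).indicator f) x‖) atTop (𝓝 L) := by
  obtain ⟨c, hc⟩ := hs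
  set u : ℕ → Eu n → 𝕜 := fun k => (ball (0 : Eu n) k).indicator f with hu
  have h1 : ∀ᵐ x, ∀ j k : ℕ, |‖T (u k) x‖ - ‖T (u j) x‖| ≤ ‖T (u k - u j) x‖ := by
    simp_rw [ae_all_iff]
    exact fun j k => hT.abs_norm_sub_norm_le (hD _ _) (hD _ _)
  have h2 : ∀ᵐ x, ∀ j k : ℕ, j ≤ k → x ∈ ball (0 : Eu n) j → ‖T (u k - u j) x‖ₑ ≤
      c * ∫⁻ y in (ball (0 : Eu n) j)ᶜ, K x y * ‖f y‖ₑ := by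
    simp_rw [ae_all_iff]
    exact fun j k hjk => enorm_apply_sub_indicator_le hc hf.locallyIntegrable hD
      (ball_subset_ball (by exact_mod_cast hjk))
  filter_upwards [h1, h2] with x h1 h2
  obtain ⟨N, hN⟩ := exists_nat_gt ‖x‖
  have hcau : CauchySeq fun k : ℕ => ‖T (u (k + N)) x‖ := by
    rw [EMetric.cauchySeq_iff_le_tendsto_0]
    refine ⟨fun k => 2 * (c * ∫⁻ y in (ball (0 : Eu n) ((k + N : ℕ) : ℝ))ᶜ, K x y * ‖f y‖ₑ),
      fun k m j hk hm => ?_, ?_⟩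
    · have key : ∀ i, j ≤ i → edist ‖T (u (i + N)) x‖ ‖T (u (j + N)) x‖ ≤
          c * ∫⁻ y in (ball (0 : Eu n) ((j + N : ℕ) : ℝ))ᶜ, K x y * ‖f y‖ₑ := by
        intro i hi
        refine le_trans ?_ (h2 (j + N) (i + N) (by lia) ?_)
        · rw [edist_dist, Real.dist_eq, ← ofReal_norm]
          exact ENNReal.ofReal_le_ofReal (h1 _ _)
        · rw [mem_ball_zero_iff]
          push_cast
          linarith [(Nat.cast_nonneg j : (0 : ℝ) ≤ j)]
      refine (edist_triangle_right _ _ ‖T (u (j + N)) x‖).trans ?_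
      simp only [two_mul]
      exact add_le_add (key k hk) (key m hm)
    · have h3 := (tendsto_add_atTop_iff_nat N).2 (hK.tendsto_tail hf x)
      have h4 := ENNReal.Tendsto.const_mul (a := 2)
        (ENNReal.Tendsto.const_mul (a := (c : ℝ≥0∞)) h3 (Or.inr (by simp))) (Or.inr (by simp))
      simpa using h4
  obtain ⟨L, hL⟩ := cauchySeq_tendsto_of_complete hcau
  exact ⟨L, (tendsto_add_atTop_iff_nat N).1 hL⟩

theorem tendsto_norm_of_memLp (hp : 0 < p)
    (hvw : volume ≪ wMeas w) (hT : IsSublinearOn D T) {A : ℝ≥0}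
    (hA : ∀ f : Eu n → 𝕜, MemLp f (ENNReal.ofReal p) (wMeas w) → f ∈ D ∧
      weakNorm p (wMeas w) (T f) ≤ A * eLpNorm f (ENNReal.ofReal p) (wMeas w))
    (hs : SizeCondition K D T)
    (hK : HasMajorant K p κ w 𝕜) {f : Eu n → 𝕜} (hf : MemMorrey p κ w f)
    (hfp : MemLp f (ENNReal.ofReal p) (wMeas w)) :
    ∀ᵐ x, Tendsto (fun k : ℕ => ‖T ((ball (0 : Eu n) k).indicator f) x‖) atTop (𝓝 ‖T f x‖) := by
  have hD : ∀ x r, (ball x r).indicator f ∈ D := fun x r =>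
    (hA _ (hfp.indicator measurableSet_ball)).1
  set u : ℕ → Eu n → 𝕜 := fun k => (ball (0 : Eu n) k).indicator f with hu
  have hcompl : ∀ k : ℕ, f - u k = (ball (0 : Eu n) k)ᶜ.indicator f := fun k => by
    rw [indicator_compl]
  have hlim : Tendsto (fun k : ℕ => eLpNorm (f - u k) (ENNReal.ofReal p) (wMeas w)) atTop (𝓝 0) := by
    have h1 : ∫⁻ y in (ball (0 : Eu n) (0 : ℕ))ᶜ, ‖f y‖ₑ ^ p ∂wMeas w ≠ ∞ := by
      have h2 := hfp.2
      rw [eLpNorm_eq_lintegral hp, ENNReal.rpow_lt_top_iff_of_pos (by positivity)] at h2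
      exact ((setLIntegral_le_lintegral _ _).trans_lt h2).ne
    have h3 := (tendsto_setLIntegral_compl_ball h1).ennrpow_const (1 / p)
    rw [ENNReal.zero_rpow_of_pos (by positivity)] at h3
    refine h3.congr fun k => ?_
    rw [hcompl, eLpNorm_indicator_eq_eLpNorm_restrict measurableSet_ball.compl,
      eLpNorm_eq_lintegral hp]
  have hweak : Tendsto (fun k : ℕ => weakNorm p (wMeas w) (T (f - u k))) atTop (𝓝 0) := by
    have h1 := ENNReal.Tendsto.const_mul (a := (A : ℝ≥0∞)) hlim (Or.inr (by simp))
    rw [mul_zero] at h1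
    refine tendsto_of_tendsto_of_tendsto_of_le_of_le tendsto_const_nhds h1 (fun _ => zero_le)
      fun k => (hA _ ?_).2
    rw [hcompl]
    exact hfp.indicator measurableSet_ball.compl
  obtain ⟨ns, hns, hae⟩ := (tendstoInMeasure_of_weakNorm hp hweak).exists_seq_tendsto_ae
  have hfD := (hA f hfp).1
  have h1 : ∀ᵐ x, ∀ k : ℕ, |‖T f x‖ - ‖T (u k) x‖| ≤ ‖T (f - u k) x‖ := by
    rw [ae_all_iff]
    exact fun k => hT.abs_norm_sub_norm_le hfD (hD _ _)
  filter_upwards [exists_tendsto_norm hT hs hK hf hD, hvw.ae_le hae, h1] with x ⟨L, hL⟩ h2 h3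
  have h4 : Tendsto (fun i => ‖T (u (ns i)) x‖) atTop (𝓝 ‖T f x‖) := by
    rw [tendsto_iff_dist_tendsto_zero]
    refine squeeze_zero (fun _ => dist_nonneg) (fun i => ?_) (by simpa using h2.norm)
    rw [dist_comm, Real.dist_eq]
    exact h3 (ns i)
  rwa [tendsto_nhds_unique h4 (hL.comp hns.tendsto_atTop)]

theorem tendsto_norm_of_sizeEstimate (hT : IsSublinearOn D T) (hK : HasMajorant K p κ w 𝕜)
    {f : Eu n → 𝕜} (hf : MemMorrey p κ w f) (hD : ∀ x r, (ball x r).indicator f ∈ D) (hfD : f ∈ D)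
    {c : ℝ≥0} (hc : ∀ R : ℝ, 0 < R → SizeEstimate K T c ((ball (0 : Eu n) R)ᶜ.indicator f)) :
    ∀ᵐ x, Tendsto (fun k : ℕ => ‖T ((ball (0 : Eu n) k).indicator f) x‖) atTop (𝓝 ‖T f x‖) := by
  set u : ℕ → Eu n → 𝕜 := fun k => (ball (0 : Eu n) k).indicator f with hu
  have h1 : ∀ᵐ x, ∀ k : ℕ, |‖T f x‖ - ‖T (u k) x‖| ≤ ‖T (f - u k) x‖ := by
    rw [ae_all_iff]
    exact fun k => hT.abs_norm_sub_norm_le hfD (hD _ _)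
  have h2 : ∀ᵐ x, ∀ k : ℕ, x ∈ ball (0 : Eu n) k → ‖T (f - u k) x‖ₑ ≤
      c * ∫⁻ y in (ball (0 : Eu n) k)ᶜ, K x y * ‖f y‖ₑ := by
    rw [ae_all_iff]
    intro k
    rcases k.eq_zero_or_pos with rfl | hk
    · simp
    have hcompl : f - u k = (ball (0 : Eu n) k)ᶜ.indicator f := by
      rw [indicator_compl]
    rw [hcompl]
    have hts : tsupport ((ball (0 : Eu n) k)ᶜ.indicator f) ⊆ (ball (0 : Eu n) k)ᶜ :=
      closure_minimal support_indicator_subset isOpen_ball.isClosed_compl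
    filter_upwards [hc k (by exact_mod_cast hk)] with x hx hxk
    refine (hx fun h => hts h hxk).trans (mul_le_mul_right ?_ _)
    exact lintegral_mul_enorm_indicator_le _ measurableSet_ball.compl
      (fun y => enorm_indicator_le_enorm_self _ _) fun y hy => indicator_of_notMem hy _
  filter_upwards [h1, h2] with x h1 h2
  obtain ⟨N, hN⟩ := exists_nat_gt ‖x‖
  rw [tendsto_iff_edist_tendsto_0]
  have h3 := ENNReal.Tendsto.const_mul (a := (c : ℝ≥0∞)) (hK.tendsto_tail hf x) (Or.inr (by simp))
  rw [mul_zero] at h3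
  refine tendsto_of_tendsto_of_tendsto_of_le_of_le' tendsto_const_nhds h3
    (Eventually.of_forall fun _ => zero_le) ?_
  filter_upwards [eventually_ge_atTop N] with k hk
  refine le_trans ?_ (h2 k ?_)
  · rw [edist_comm, edist_dist, Real.dist_eq, ← ofReal_norm]
    exact ENNReal.ofReal_le_ofReal (h1 k)
  · rw [mem_ball_zero_iff]
    exact hN.trans_le (by exact_mod_cast hk)

/-- The value of `T` at a Morrey function exists. -/
theorem exists_isValue (hw : IsMuckenhoupt p C (wMeas w)) (hp : 0 < p) (hκ : 0 ≤ κ)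
    (hvw : volume ≪ wMeas w) (hT : IsSublinearOn D T) {A : ℝ≥0}
    (hA : ∀ f : Eu n → 𝕜, MemLp f (ENNReal.ofReal p) (wMeas w) → f ∈ D ∧
      weakNorm p (wMeas w) (T f) ≤ A * eLpNorm f (ENNReal.ofReal p) (wMeas w))
    (hs : SizeCondition K D T)
    (hK : HasMajorant K p κ w 𝕜) {f : Eu n → 𝕜} (hf : MemMorrey p κ w f) :
    ∃ F : Eu n → 𝕜, IsValue K p w D T f F ∧ AEStronglyMeasurable F volume := by
  have hD : ∀ x r, (ball x r).indicator f ∈ D := fun x r =>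
    (hA _ (hf.memLp_indicator_ball hw hp hκ x r)).1
  by_cases h1 : MemLp f (ENNReal.ofReal p) (wMeas w)
  · exact ⟨T f, ⟨tendsto_norm_of_memLp hp hvw hT hA hs hK hf h1, fun _ => rfl, fun _ _ => rfl⟩,
      hT.measurable f (hA f h1).1⟩
  by_cases h2 : f ∈ D ∧ ∃ c : ℝ≥0, ∀ R : ℝ, 0 < R →
      SizeEstimate K T c ((ball (0 : Eu n) R)ᶜ.indicator f)
  · obtain ⟨hfD, c, hc⟩ := h2
    exact ⟨T f, ⟨tendsto_norm_of_sizeEstimate hT hK hf hD hfD hc, fun _ => rfl, fun _ _ => rfl⟩,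
      hT.measurable f hfD⟩
  have hlim := exists_tendsto_norm hT hs hK hf hD
  set L : Eu n → ℝ := fun x => limUnder atTop
    fun k : ℕ => ‖T ((ball (0 : Eu n) k).indicator f) x‖ with hL
  have hlim' : ∀ᵐ x, Tendsto (fun k : ℕ => ‖T ((ball (0 : Eu n) k).indicator f) x‖) atTop
      (𝓝 (L x)) := hlim.mono fun x hx => tendsto_nhds_limUnder hx
  refine ⟨fun x => (L x : 𝕜), ⟨hlim'.mono fun x hx => ?_, fun h => absurd h h1,
    fun h h' => absurd ⟨h, h'⟩ h2⟩, ?_⟩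
  · have h0 : 0 ≤ L x := ge_of_tendsto' hx fun _ => norm_nonneg _
    rwa [RCLike.norm_of_nonneg h0]
  · refine aestronglyMeasurable_of_tendsto_ae atTop
      (f := fun (k : ℕ) x => ((‖T ((ball (0 : Eu n) k).indicator f) x‖ : ℝ) : 𝕜)) (fun k => ?_)
      (hlim'.mono fun x hx => (RCLike.continuous_ofReal.tendsto _).comp hx)
    exact RCLike.continuous_ofReal.comp_aestronglyMeasurable (hT.measurable _ (hD _ _)).norm

theorem IsValue.enorm_le (hT : IsSublinearOn D T) {c : ℝ≥0}
    (hc : ∀ f ∈ D, MemLp f 1 volume → HasCompactSupport f → SizeEstimate K T c f)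
    {f F : Eu n → 𝕜} (hf : LocallyIntegrable f volume) (hD : ∀ x r, (ball x r).indicator f ∈ D)
    (hF : IsValue K p w D T f F) (x₀ : Eu n) (s : ℝ) :
    ∀ᵐ x, x ∈ ball x₀ s → ‖F x‖ₑ ≤
      ‖T ((ball x₀ s).indicator f) x‖ₑ + c * ∫⁻ y in (ball x₀ s)ᶜ, K x y * ‖f y‖ₑ := by
  set u : ℕ → Eu n → 𝕜 := fun k => (ball (0 : Eu n) k).indicator f with hu
  obtain ⟨N, hN⟩ := exists_nat_gt (s + ‖x₀‖)
  have hsub : ∀ k, N ≤ k → ball x₀ s ⊆ ball (0 : Eu n) k := fun k hk => by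
    refine ball_subset_ball' ?_
    rw [dist_zero_right]
    exact hN.le.trans (by exact_mod_cast hk)
  have h1 : ∀ᵐ x, ∀ k : ℕ, |‖T (u k) x‖ - ‖T ((ball x₀ s).indicator f) x‖| ≤
      ‖T (u k - (ball x₀ s).indicator f) x‖ := by
    rw [ae_all_iff]
    exact fun k => hT.abs_norm_sub_norm_le (hD _ _) (hD _ _)
  have h2 : ∀ᵐ x, ∀ k : ℕ, N ≤ k → x ∈ ball x₀ s →
      ‖T (u k - (ball x₀ s).indicator f) x‖ₑ ≤
      c * ∫⁻ y in (ball x₀ s)ᶜ, K x y * ‖f y‖ₑ := by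
    simp_rw [ae_all_iff]
    exact fun k hk => enorm_apply_sub_indicator_le hc hf hD (hsub k hk)
  filter_upwards [h1, h2, hF.tendsto] with x h1 h2 h3 hx
  have h4 : Tendsto (fun k : ℕ => ‖T (u k) x‖ₑ) atTop (𝓝 ‖F x‖ₑ) := by
    simp only [← ofReal_norm]
    exact ENNReal.tendsto_ofReal h3
  refine le_of_tendsto h4 ?_
  filter_upwards [eventually_ge_atTop N] with k hk
  refine le_trans ?_ (add_le_add_right (h2 k hk hx) _)
  simp only [← ofReal_norm]
  rw [← ENNReal.ofReal_add (norm_nonneg _) (norm_nonneg _)]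
  exact ENNReal.ofReal_le_ofReal (by linarith [le_abs_self (‖T (u k) x‖ -
    ‖T ((ball x₀ s).indicator f) x‖), h1 k])

end Value

section Bounded

variable {K : Eu n → Eu n → ℝ≥0∞} {p κ : ℝ} {w : Eu n → ℝ} {C : ℝ≥0}
  {D : Submodule 𝕜 (Eu n → 𝕜)} {T : (Eu n → 𝕜) → Eu n → 𝕜}

theorem locallyIntegrable_of_eLpNorm_ball (hw : IsMuckenhoupt p C (wMeas w)) (hp : 0 < p)
    {F : Eu n → 𝕜} (hF : AEStronglyMeasurable F volume)
    (h : ∀ x r, 0 < r → eLpNorm F (ENNReal.ofReal p) ((wMeas w).restrict (ball x r)) < ∞) :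
    LocallyIntegrable F volume := by
  intro x
  refine ⟨ball x 1, ball_mem_nhds x one_pos, hF.restrict, ?_⟩
  have h1 := hw.lintegral_mul_le x 1 one_pos (fun y => ‖F y‖ₑ) hF.enorm
  rw [← eLpNorm_eq_lintegral hp] at h1
  have h2 := h1.trans_lt (ENNReal.mul_lt_top (ENNReal.mul_lt_top ENNReal.coe_lt_top
    measure_ball_lt_top) (h x 1 one_pos))
  refine lt_top_iff_ne_top.2 fun h3 => ?_
  rw [h3, ENNReal.top_mul] at h2
  · exact absurd h2 (lt_irrefl _)
  · exact (ENNReal.rpow_pos (hw.pos x 1 one_pos) (hw.lt_top x 1).ne).ne'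

theorem eLpNorm_indicator_two_mul_ball_le (hw : IsMuckenhoupt p C (wMeas w)) (hp : 0 < p)
    (hκ : 0 ≤ κ) (f : Eu n → 𝕜) (x : Eu n) {r : ℝ} (hr : 0 < r) :
    eLpNorm ((ball x (2 * r)).indicator f) (ENNReal.ofReal p) (wMeas w) ≤
      ((((C * 2 ^ n) ^ p) ^ (κ / p) : ℝ≥0) : ℝ≥0∞) * morreyNorm p κ w f *
        wMeas w (ball x r) ^ (κ / p) := by
  have hκp : 0 ≤ κ / p := by positivity
  rw [eLpNorm_indicator_eq_eLpNorm_restrict measurableSet_ball]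
  refine (eLpNorm_ball_le_morreyNorm (κ := κ) hw f x (by positivity)).trans ?_
  calc _ ≤ morreyNorm p κ w f *
        ((((C * 2 ^ n) ^ p : ℝ≥0) : ℝ≥0∞) * wMeas w (ball x r)) ^ (κ / p) := by
        gcongr
        exact hw.measure_two_mul_le hp x hr
    _ = _ := by
        rw [ENNReal.mul_rpow_of_nonneg _ _ hκp, ← ENNReal.coe_rpow_of_nonneg _ hκp]
        ring

theorem rpow_neg_mul_le_of_le_mul_rpow {ν a b : ℝ≥0∞} {s p : ℝ} (h0 : ν ≠ 0) (ht : ν ≠ ∞)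
    (h : a ≤ b * ν ^ (s / p)) : ν ^ (-s / p) * a ≤ b := by
  calc _ ≤ ν ^ (-s / p) * (b * ν ^ (s / p)) := by gcongr
    _ = b * (ν ^ (-s / p) * ν ^ (s / p)) := by ring
    _ = b := by rw [← ENNReal.rpow_add _ _ h0 ht]; simp [neg_div]

theorem boundedOnMorrey_of_hasMajorant (hw : IsMuckenhoupt p C (wMeas w)) (hp : 1 ≤ p)
    (hκ : 0 ≤ κ) (hvw : volume ≪ wMeas w) (hT : IsSublinearOn D T) (hA : BoundedOnLp p w D T)
    (hs : SizeCondition K D T) (hK : HasMajorant K p κ w 𝕜) :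
    BoundedOnMorrey K p κ w D T := by
  have hp0 : 0 < p := by linarith
  obtain ⟨A, hA⟩ := hA
  have hA' : ∀ f : Eu n → 𝕜, MemLp f (ENNReal.ofReal p) (wMeas w) → f ∈ D ∧
      weakNorm p (wMeas w) (T f) ≤ A * eLpNorm f (ENNReal.ofReal p) (wMeas w) := fun f hf =>
    ⟨(hA f hf).1, (weakNorm_le_eLpNorm hp0 ((hT.measurable f (hA f hf).1).mono_ac hw.ac)).trans
      (hA f hf).2⟩
  have hs' := hs
  obtain ⟨c, hc⟩ := hs'
  have hK' := hK
  obtain ⟨B, hB⟩ := hK'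
  set N : ℝ≥0 := ((C * 2 ^ n) ^ p) ^ (κ / p)
  refine ⟨A * N + c * B, fun f hf => ?_⟩
  have hD : ∀ x r, (ball x r).indicator f ∈ D := fun x r =>
    (hA _ (hf.memLp_indicator_ball hw hp0 hκ x r)).1
  obtain ⟨F, hF, hFm⟩ := exists_isValue hw hp0 hκ hvw hT hA' hs hK hf
  have key : ∀ x r, 0 < r → eLpNorm F (ENNReal.ofReal p) ((wMeas w).restrict (ball x r)) ≤
      ((A * N + c * B : ℝ≥0) : ℝ≥0∞) * morreyNorm p κ w f * wMeas w (ball x r) ^ (κ / p) := by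
    intro x r hr
    obtain ⟨h, -, hm, hle, hnorm⟩ := hB f hf x r hr
    set g := (ball x (2 * r)).indicator f
    have hTg : AEStronglyMeasurable (T g) (wMeas w) :=
      (hT.measurable g (hD _ _)).mono_ac hw.ac
    have hpt : ∀ᵐ y ∂(wMeas w).restrict (ball x r), ‖F y‖ₑ ≤ ‖T g y‖ₑ + c * h y := by
      rw [ae_restrict_iff' measurableSet_ball]
      filter_upwards [hw.ac.ae_le (hF.enorm_le hT hc hf.locallyIntegrable hD x (2 * r))]
        with y hy hyB
      refine (hy (ball_subset_ball (by linarith) hyB)).trans ?_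
      gcongr
      exact hle y hyB
    calc eLpNorm F (ENNReal.ofReal p) ((wMeas w).restrict (ball x r))
        = (∫⁻ y in ball x r, ‖F y‖ₑ ^ p ∂wMeas w) ^ (1 / p) := eLpNorm_eq_lintegral hp0 _ _
      _ ≤ (∫⁻ y in ball x r, ((fun y => ‖T g y‖ₑ) + fun y => c * h y) y ^ p ∂wMeas w) ^ (1 / p) := by
          refine ENNReal.rpow_le_rpow (lintegral_mono_ae ?_) (by positivity)
          filter_upwards [hpt] with y hy
          exact ENNReal.rpow_le_rpow hy hp0.le
      _ ≤ (∫⁻ y in ball x r, ‖T g y‖ₑ ^ p ∂wMeas w) ^ (1 / p) +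
          (∫⁻ y in ball x r, (c * h y) ^ p ∂wMeas w) ^ (1 / p) :=
          ENNReal.lintegral_Lp_add_le hTg.enorm.restrict
            ((hm.mono_ac hw.ac).const_mul _).restrict hp
      _ ≤ A * (N * morreyNorm p κ w f * wMeas w (ball x r) ^ (κ / p)) +
          c * (B * morreyNorm p κ w f * wMeas w (ball x r) ^ (κ / p)) := by
          refine add_le_add ?_ ?_
          · rw [← eLpNorm_eq_lintegral hp0]
            refine (eLpNorm_mono_measure _ Measure.restrict_le_self).trans ?_
            refine (hA g (hf.memLp_indicator_ball hw hp0 hκ _ _)).2.trans ?_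
            gcongr
            exact eLpNorm_indicator_two_mul_ball_le hw hp0 hκ f x hr
          · simp_rw [ENNReal.mul_rpow_of_nonneg _ _ hp0.le]
            rw [lintegral_const_mul' _ _ (ENNReal.rpow_ne_top_of_nonneg hp0.le ENNReal.coe_ne_top),
              ENNReal.mul_rpow_of_nonneg _ _ (by positivity), ← ENNReal.rpow_mul,
              mul_one_div_cancel hp0.ne', ENNReal.rpow_one]
            gcongr
      _ = _ := by push_cast; ring
  refine ⟨F, hF, ?_⟩
  have hnorm : morreyNorm p κ w F ≤ ((A * N + c * B : ℝ≥0) : ℝ≥0∞) * morreyNorm p κ w f :=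
    iSup_le fun x => iSup_le fun r => iSup_le fun hr =>
      rpow_neg_mul_le_of_le_mul_rpow (hw.pos x r hr).ne' (hw.lt_top x r).ne (key x r hr)
  refine ⟨⟨locallyIntegrable_of_eLpNorm_ball hw hp0 hFm fun x r hr => (key x r hr).trans_lt ?_,
    hnorm.trans_lt (ENNReal.mul_lt_top ENNReal.coe_lt_top hf.norm_lt_top)⟩, hnorm⟩
  exact ENNReal.mul_lt_top (ENNReal.mul_lt_top ENNReal.coe_lt_top hf.norm_lt_top)
    (ENNReal.rpow_lt_top_of_nonneg (by positivity) (hw.lt_top x r).ne)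

theorem boundedToWeakMorrey_of_hasMajorant (hw : IsMuckenhoupt 1 C (wMeas w))
    (hκ : 0 ≤ κ) (hvw : volume ≪ wMeas w) (hT : IsSublinearOn D T) (hA : BoundedWeakL1 w D T)
    (hs : SizeCondition K D T) (hK : HasMajorant K 1 κ w 𝕜) :
    BoundedToWeakMorrey K 1 κ w D T := by
  obtain ⟨A, hA⟩ := hA
  rw [← ENNReal.ofReal_one] at hA
  have hs' := hs
  obtain ⟨c, hc⟩ := hs'
  have hK' := hK
  obtain ⟨B, hB⟩ := hK'
  set N : ℝ≥0 := ((C * 2 ^ n) ^ (1 : ℝ)) ^ (κ / 1) with hN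
  refine ⟨2 * (A * N + c * B), fun f hf => ?_⟩
  have hD : ∀ x r, (ball x r).indicator f ∈ D := fun x r =>
    (hA _ (hf.memLp_indicator_ball hw one_pos hκ x r)).1
  obtain ⟨F, hF, hFm⟩ := exists_isValue hw one_pos hκ hvw hT hA hs hK hf
  have key : ∀ x r, 0 < r → weakNorm 1 ((wMeas w).restrict (ball x r)) F ≤
      ((2 * (A * N + c * B) : ℝ≥0) : ℝ≥0∞) * morreyNorm 1 κ w f *
        wMeas w (ball x r) ^ (κ / 1) := by
    intro x r hr
    obtain ⟨h, -, hm, hle, hnorm⟩ := hB f hf x r hr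
    simp only [div_one, ENNReal.rpow_one] at hnorm
    set g := (ball x (2 * r)).indicator f
    set μ := (wMeas w).restrict (ball x r)
    have hpt : ∀ᵐ y ∂μ, ‖F y‖ₑ ≤ ‖T g y‖ₑ + c * h y := by
      rw [ae_restrict_iff' measurableSet_ball]
      filter_upwards [hw.ac.ae_le (hF.enorm_le hT hc hf.locallyIntegrable hD x (2 * r))]
        with y hy hyB
      refine (hy (ball_subset_ball (by linarith) hyB)).trans ?_
      gcongr
      exact hle y hyB
    refine iSup_le fun t => ?_
    have h1 : μ {y | (t : ℝ≥0∞) < ‖F y‖ₑ} ≤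
        wMeas w {y | ((t / 2 : ℝ≥0) : ℝ≥0∞) < ‖T g y‖ₑ} +
          μ {y | ((t / 2 : ℝ≥0) : ℝ≥0∞) ≤ c * h y} := by
      calc _ ≤ μ ({y | ((t / 2 : ℝ≥0) : ℝ≥0∞) < ‖T g y‖ₑ} ∪
            {y | ((t / 2 : ℝ≥0) : ℝ≥0∞) ≤ c * h y}) := by
            refine measure_mono_ae ?_
            filter_upwards [hpt] with y hy ht
            by_contra hcon
            have hc1 : ‖T g y‖ₑ ≤ ((t / 2 : ℝ≥0) : ℝ≥0∞) := not_lt.1 fun h' => hcon (Or.inl h')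
            have hc2 : c * h y ≤ ((t / 2 : ℝ≥0) : ℝ≥0∞) :=
              le_of_not_ge fun h' => hcon (Or.inr h')
            have h2 : ((t / 2 : ℝ≥0) : ℝ≥0∞) + ((t / 2 : ℝ≥0) : ℝ≥0∞) = t := by
              rw [← ENNReal.coe_add, add_halves]
            have h3 : ‖F y‖ₑ ≤ t := hy.trans (h2 ▸ add_le_add hc1 hc2)
            exact h3.not_gt ht
        _ ≤ _ := (measure_union_le _ _).trans (add_le_add_left (Measure.restrict_le_self _) _)
    have h2 : ((t / 2 : ℝ≥0) : ℝ≥0∞) * wMeas w {y | ((t / 2 : ℝ≥0) : ℝ≥0∞) < ‖T g y‖ₑ} ≤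
        A * (N * morreyNorm 1 κ w f * wMeas w (ball x r) ^ (κ / 1)) := by
      have h3 := le_weakNorm 1 (wMeas w) (T g) (t / 2)
      rw [div_one, ENNReal.rpow_one] at h3
      refine h3.trans ((hA g (hf.memLp_indicator_ball hw one_pos hκ _ _)).2.trans ?_)
      gcongr
      exact eLpNorm_indicator_two_mul_ball_le hw one_pos hκ f x hr
    have h3 : ((t / 2 : ℝ≥0) : ℝ≥0∞) * μ {y | ((t / 2 : ℝ≥0) : ℝ≥0∞) ≤ c * h y} ≤
        c * (B * morreyNorm 1 κ w f * wMeas w (ball x r) ^ (κ / 1)) := by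
      refine (mul_meas_ge_le_lintegral₀ ((hm.mono_ac hw.ac).const_mul _).restrict _).trans ?_
      rw [lintegral_const_mul' _ _ ENNReal.coe_ne_top]
      gcongr
      simpa using hnorm
    have h4 : (t : ℝ≥0∞) = 2 * ((t / 2 : ℝ≥0) : ℝ≥0∞) := by
      rw [← ENNReal.coe_ofNat, ← ENNReal.coe_mul, mul_div_cancel₀ _ (by norm_num)]
    rw [div_one, ENNReal.rpow_one]
    calc (t : ℝ≥0∞) * μ {y | (t : ℝ≥0∞) < ‖F y‖ₑ}
        ≤ 2 * (((t / 2 : ℝ≥0) : ℝ≥0∞) * wMeas w {y | ((t / 2 : ℝ≥0) : ℝ≥0∞) < ‖T g y‖ₑ} +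
          ((t / 2 : ℝ≥0) : ℝ≥0∞) * μ {y | ((t / 2 : ℝ≥0) : ℝ≥0∞) ≤ c * h y}) := by
          rw [← mul_add, ← mul_assoc, ← h4]
          gcongr
      _ ≤ 2 * (A * (N * morreyNorm 1 κ w f * wMeas w (ball x r) ^ (κ / 1)) +
          c * (B * morreyNorm 1 κ w f * wMeas w (ball x r) ^ (κ / 1))) := by gcongr
      _ = _ := by push_cast; ring
  have hnorm : weakMorreyNorm 1 κ w F ≤
      ((2 * (A * N + c * B) : ℝ≥0) : ℝ≥0∞) * morreyNorm 1 κ w f :=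
    iSup_le fun x => iSup_le fun r => iSup_le fun hr =>
      rpow_neg_mul_le_of_le_mul_rpow (hw.pos x r hr).ne' (hw.lt_top x r).ne (key x r hr)
  exact ⟨F, hF, ⟨hFm, hnorm.trans_lt (ENNReal.mul_lt_top ENNReal.coe_lt_top hf.norm_lt_top)⟩,
    hnorm⟩

end Bounded

section Average

theorem enorm_setAverage_sub_mul_le {S : Set (Eu n)} (hSt : volume S ≠ ∞)
    {b : Eu n → 𝕜} (hb : IntegrableOn b S volume) (c : 𝕜) :
    ‖(⨍ y in S, b y) - c‖ₑ * volume S ≤ ∫⁻ y in S, ‖b y - c‖ₑ := by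
  have h1 : ∫ y in S, (b y - c) = volume.real S • ((⨍ y in S, b y) - c) := by
    rw [integral_sub hb (integrableOn_const hSt), setIntegral_const, smul_sub,
      measure_smul_setAverage _ hSt]
  have h2 := enorm_integral_le_lintegral_enorm (μ := volume.restrict S) (fun y => b y - c)
  rw [h1, enorm_smul, mul_comm] at h2
  rwa [measureReal_def, Real.enorm_eq_ofReal ENNReal.toReal_nonneg, ENNReal.ofReal_toReal hSt] at h2

theorem lintegral_enorm_sub_setAverage_le {S : Set (Eu n)}
    (hSt : volume S ≠ ∞) {b : Eu n → 𝕜} (hb : IntegrableOn b S volume) (c : 𝕜) :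
    ∫⁻ y in S, ‖b y - ⨍ z in S, b z‖ₑ ≤ 2 * ∫⁻ y in S, ‖b y - c‖ₑ := by
  calc ∫⁻ y in S, ‖b y - ⨍ z in S, b z‖ₑ
      ≤ ∫⁻ y in S, (‖b y - c‖ₑ + ‖(⨍ z in S, b z) - c‖ₑ) := by
        refine lintegral_mono fun y => ?_
        rw [← sub_sub_sub_cancel_right (b y) _ c]
        exact enorm_sub_le
    _ = (∫⁻ y in S, ‖b y - c‖ₑ) + ‖(⨍ z in S, b z) - c‖ₑ * volume S := by
        rw [lintegral_add_right _ measurable_const, setLIntegral_const]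
    _ ≤ _ := by
        rw [two_mul]
        gcongr
        exact enorm_setAverage_sub_mul_le hSt hb c

theorem MemBMO.lintegral_ball_le {b : Eu n → 𝕜} (x : Eu n) {r : ℝ} (hr : 0 < r) :
    ∫⁻ y in ball x r, ‖b y - ⨍ z in ball x r, b z‖ₑ ≤ bmoNorm b * volume (ball x r) := by
  have h1 : ⨍⁻ y in ball x r, ‖b y - (⨍ z in ball x r, b z ∂volume)‖ₑ ∂volume ≤ bmoNorm b :=
    le_iSup_of_le x (le_iSup_of_le r (le_iSup_of_le hr le_rfl))
  rwa [setLAverage_eq, ENNReal.div_le_iff (volume_ball_pos' x hr) measure_ball_lt_top.ne] at h1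

theorem _root_.MeasureTheory.LocallyIntegrable.integrableOn_subset_ball {b : Eu n → 𝕜}
    (hb : LocallyIntegrable b volume) {S : Set (Eu n)} {x : Eu n} {r : ℝ} (hS : S ⊆ ball x r) :
    IntegrableOn b S volume :=
  (hb.integrableOn_isCompact (isCompact_closedBall x r)).mono_set (hS.trans ball_subset_closedBall)

end Average

section Dyadic

variable (a : Eu n) (s : ℝ)

/-- The index of the half-open dyadic cube of generation `m`, in the grid with origin `a` and
initial side length `s`, that contains `x`. -/
def dyadicIndex (m : ℕ) (x : Eu n) : Fin n → ℤ := fun i => ⌊(x i - a i) / (s / 2 ^ m)⌋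

/-- The half-open dyadic cube of generation `m` and index `k`. -/
def dyadicCube (m : ℕ) (k : Fin n → ℤ) : Set (Eu n) := {x | dyadicIndex a s m x = k}

/-- The centre of a dyadic cube. -/
def dyadicCenter (m : ℕ) (k : Fin n → ℤ) : Eu n :=
  WithLp.toLp 2 fun i => a i + s / 2 ^ m * (k i + 1 / 2)

variable {a s}

theorem mem_dyadicCube {m : ℕ} {k : Fin n → ℤ} {x : Eu n} :
    x ∈ dyadicCube a s m k ↔ dyadicIndex a s m x = k := Iff.rfl

theorem dyadicIndex_eq_div (m : ℕ) (x : Eu n) (i : Fin n) :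
    dyadicIndex a s m x i = dyadicIndex a s (m + 1) x i / 2 := by
  have h : (x i - a i) / (s / 2 ^ (m + 1)) = ((2 : ℕ) : ℝ) * ((x i - a i) / (s / 2 ^ m)) := by
    rw [pow_succ, ← div_div s, div_div_eq_mul_div]
    push_cast; ring
  have h2 := Int.natCast_mul_floor_div_cancel two_ne_zero ((x i - a i) / (s / 2 ^ m))
  rw [dyadicIndex, dyadicIndex, h, ← h2]
  simp

theorem dyadicIndex_eq_of_le {m l : ℕ} (hl : l ≤ m) {x y : Eu n}
    (h : dyadicIndex a s m x = dyadicIndex a s m y) :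
    dyadicIndex a s l x = dyadicIndex a s l y := by
  induction m, hl using Nat.le_induction with
  | base => exact h
  | succ m hm ih =>
    refine ih (funext fun i => ?_)
    rw [dyadicIndex_eq_div m x, dyadicIndex_eq_div m y, h]

theorem measurableSet_dyadicCube (m : ℕ) (k : Fin n → ℤ) : MeasurableSet (dyadicCube a s m k) := by
  have : Measurable (dyadicIndex a s m) := by
    refine measurable_pi_iff.2 fun i => Int.measurable_floor.comp ?_
    have h : Measurable fun x : Eu n => x i := by fun_prop
    exact (h.sub_const _).div_const _
  exact this (measurableSet_singleton k)

theorem ball_subset_dyadicCube (hs : 0 < s) (m : ℕ) (k : Fin n → ℤ) :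
    ball (dyadicCenter a s m k) (s / 2 ^ m / 2) ⊆ dyadicCube a s m k := by
  intro x hx
  have hh : 0 < s / 2 ^ m := by positivity
  set h := s / 2 ^ m with hh_def
  refine funext fun i => ?_
  have h1 : ‖(x - dyadicCenter a s m k) i‖ < h / 2 :=
    (PiLp.norm_apply_le _ i).trans_lt (by rwa [← dist_eq_norm])
  have h2 : (x - dyadicCenter a s m k) i = x i - (a i + h * (k i + 1 / 2)) := rfl
  rw [h2, Real.norm_eq_abs, abs_lt] at h1
  rw [dyadicIndex, Int.floor_eq_iff, le_div_iff₀ hh, div_lt_iff₀ hh]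
  constructor <;> nlinarith [h1.1, h1.2]

theorem dyadicCube_subset_ball (hs : 0 < s) (hn : 1 ≤ n) (m : ℕ) (k : Fin n → ℤ) :
    dyadicCube a s m k ⊆ ball (dyadicCenter a s m k) (n * (s / 2 ^ m)) := by
  intro x hx
  have hh : 0 < s / 2 ^ m := by positivity
  rw [mem_dyadicCube] at hx
  set h := s / 2 ^ m with hh_def
  have hn' : (1 : ℝ) ≤ n := by exact_mod_cast hn
  have h1 : ∀ i, ‖(x - dyadicCenter a s m k) i‖ ^ 2 ≤ (h / 2) ^ 2 := fun i => by
    have h2 : (x - dyadicCenter a s m k) i = x i - (a i + h * (k i + 1 / 2)) := rfl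
    have h3 := congrFun hx i
    rw [dyadicIndex, Int.floor_eq_iff, ← hh_def, le_div_iff₀ hh, div_lt_iff₀ hh] at h3
    rw [h2, Real.norm_eq_abs]
    refine pow_le_pow_left₀ (abs_nonneg _) (abs_le.2 ?_) 2
    constructor <;> nlinarith [h3.1, h3.2]
  rw [mem_ball, dist_eq_norm]
  refine lt_of_pow_lt_pow_left₀ 2 (by positivity) ?_
  rw [EuclideanSpace.norm_sq_eq]
  refine (Finset.sum_le_sum fun i _ => h1 i).trans_lt ?_
  rw [Finset.sum_const, Finset.card_univ, Fintype.card_fin, nsmul_eq_mul]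
  have h4 : (n : ℝ) ≤ (n : ℝ) ^ 2 := by nlinarith
  have h5 : 0 < h ^ 2 := by positivity
  nlinarith

theorem volume_ball_le_dyadicCube (hs : 0 < s) (y : Eu n) {R : ℝ} (K : ℝ≥0) (m : ℕ) (k : Fin n → ℤ)
    (hR : R ≤ K * (s / 2 ^ m / 2)) :
    volume (ball y R) ≤ ((K ^ n : ℝ≥0) : ℝ≥0∞) * volume (dyadicCube a s m k) :=
  (volume_ball_le_mul y (dyadicCenter a s m k) K (by positivity) hR).trans
    (mul_le_mul_right (measure_mono (ball_subset_dyadicCube hs m k)) _)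

theorem volume_dyadicCube_ne_zero (hs : 0 < s) (m : ℕ) (k : Fin n → ℤ) :
    volume (dyadicCube a s m k) ≠ 0 := fun h =>
  volume_ball_pos' (dyadicCenter a s m k) (r := s / 2 ^ m / 2) (by positivity)
    (measure_mono_null (ball_subset_dyadicCube hs m k) h)

theorem volume_dyadicCube_ne_top (hs : 0 < s) (hn : 1 ≤ n) (m : ℕ) (k : Fin n → ℤ) :
    volume (dyadicCube a s m k) ≠ ∞ :=
  ((measure_mono (dyadicCube_subset_ball hs hn m k)).trans_lt measure_ball_lt_top).ne

/-- The volume of a cube is controlled by the volume of its children. -/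
theorem volume_dyadicCube_le_succ (hs : 0 < s) (hn : 1 ≤ n) (m : ℕ) (k k' : Fin n → ℤ) :
    volume (dyadicCube a s m k) ≤
      (((4 * n) ^ n : ℝ≥0) : ℝ≥0∞) * volume (dyadicCube a s (m + 1) k') := by
  refine (measure_mono (dyadicCube_subset_ball hs hn m k)).trans
    (volume_ball_le_dyadicCube hs _ _ _ _ (le_of_eq ?_))
  push_cast
  rw [pow_succ]
  field_simp
  ring

/-- Functions of bounded mean oscillation have bounded oscillation over cubes. -/
theorem MemBMO.lintegral_dyadicCube_le (hs : 0 < s) (hn : 1 ≤ n) {b : Eu n → 𝕜} (hb : MemBMO b) (m : ℕ)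
    (k : Fin n → ℤ) :
    ∫⁻ y in dyadicCube a s m k, ‖b y - ⨍ z in dyadicCube a s m k, b z‖ₑ ≤
      2 * bmoNorm b * (((2 * n) ^ n : ℝ≥0) : ℝ≥0∞) * volume (dyadicCube a s m k) := by
  have hsub := dyadicCube_subset_ball (a := a) hs hn m k
  have hr : 0 < (n : ℝ) * (s / 2 ^ m) := mul_pos (by exact_mod_cast hn) (by positivity)
  refine (lintegral_enorm_sub_setAverage_le (volume_dyadicCube_ne_top hs hn m k) (hb.locallyIntegrable.integrableOn_subset_ball hsub)
    (⨍ z in ball (dyadicCenter a s m k) (n * (s / 2 ^ m)), b z)).trans ?_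
  rw [mul_assoc, mul_assoc]
  gcongr
  refine (lintegral_mono_set hsub).trans ((MemBMO.lintegral_ball_le _ hr).trans ?_)
  gcongr
  refine volume_ball_le_dyadicCube hs _ _ _ _ (le_of_eq ?_)
  push_cast; ring

/-- The weak form of the `A_∞` property on cubes. -/
theorem IsMuckenhoupt.exists_measure_dyadicCube_le {p : ℝ} {C : ℝ≥0} {ν : Measure (Eu n)}
    (h : IsMuckenhoupt p C ν) (hp : 0 < p) (hn : 1 ≤ n) :
    ∃ η : ℝ≥0, η < 1 ∧ ∀ (a : Eu n) (s : ℝ), 0 < s → ∀ (m : ℕ) (k : Fin n → ℤ) (E : Set (Eu n)),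
      MeasurableSet E → E ⊆ dyadicCube a s m k →
      2 * volume E ≤ volume (dyadicCube a s m k) → ν E ≤ η * ν (dyadicCube a s m k) := by
  set D : ℝ≥0 := (C * ((2 * n) ^ n * 2)) ^ p with hD
  refine ⟨D / (1 + D), ?_, fun a s hs m k E hE hEQ hvol => ?_⟩
  · rw [div_lt_one (by positivity)]
    exact lt_one_add D
  set Q := dyadicCube a s m k with hQ
  have hQm : MeasurableSet Q := measurableSet_dyadicCube m k
  have hsub : Q ⊆ ball (dyadicCenter a s m k) (n * (s / 2 ^ m)) := dyadicCube_subset_ball hs hn m k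
  have hr : 0 < (n : ℝ) * (s / 2 ^ m) := mul_pos (by exact_mod_cast hn) (by positivity)
  have hQt := volume_dyadicCube_ne_top (a := a) hs hn m k
  have hEt : volume E ≠ ∞ := ((measure_mono hEQ).trans_lt hQt.lt_top).ne
  have h1 : volume Q ≤ 2 * volume (Q \ E) := by
    have h2 : volume E + volume (Q \ E) = volume Q := by
      rw [← measure_inter_add_sdiff Q hE, inter_eq_right.2 hEQ]
    have h3 : volume E ≤ volume (Q \ E) := by
      rw [← h2, two_mul] at hvol
      exact (ENNReal.add_le_add_iff_left hEt).1 hvol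
    rw [← h2, two_mul]
    gcongr
  have hvolB : volume (ball (dyadicCenter a s m k) (n * (s / 2 ^ m))) ≤
      (((2 * n) ^ n * 2 : ℝ≥0) : ℝ≥0∞) * volume (Q \ E) := by
    refine (volume_ball_le_dyadicCube (a := a) hs _ (2 * n) m k (le_of_eq (by push_cast; ring))).trans ?_
    push_cast
    rw [mul_assoc]
    gcongr
  have h4 : ν Q ≤ D * ν (Q \ E) := (measure_mono hsub).trans
    (h.measure_ball_le hp hr (hQm.diff hE) (sdiff_subset.trans hsub) hvolB)
  have h5 : ν E + ν (Q \ E) = ν Q := by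
    rw [← measure_inter_add_sdiff Q hE, inter_eq_right.2 hEQ]
  have h6 : (1 + D : ℝ≥0) * ν E ≤ D * ν Q := by
    calc ((1 + D : ℝ≥0) : ℝ≥0∞) * ν E = ν E + D * ν E := by push_cast; ring
      _ ≤ D * ν (Q \ E) + D * ν E := by
          gcongr
          exact (measure_mono hEQ).trans h4
      _ = D * ν Q := by rw [← h5]; ring
  rw [ENNReal.coe_div (by positivity), div_eq_mul_inv, mul_right_comm, ← div_eq_mul_inv,
    ENNReal.le_div_iff_mul_le (Or.inl (by simp)) (Or.inl (by simp)), mul_comm]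
  exact h6

end Dyadic

section JohnNirenberg

variable {a : Eu n} {s : ℝ}

/-- Lebesgue differentiation along dyadic cubes. -/
theorem ae_tendsto_dyadicCube (hs : 0 < s) (hn : 1 ≤ n) {b : Eu n → 𝕜}
    (hb : LocallyIntegrable b volume) :
    ∀ᵐ x, Tendsto (fun m : ℕ => (∫⁻ y in dyadicCube a s m (dyadicIndex a s m x), ‖b y - b x‖ₑ) /
      volume (dyadicCube a s m (dyadicIndex a s m x))) atTop (𝓝 0) := by
  filter_upwards [(IsUnifLocDoublingMeasure.vitaliFamily (volume : Measure (Eu n))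
    1).ae_tendsto_lintegral_enorm_sub_div hb] with x hx
  set δ : ℕ → ℝ := fun m => 2 * (n * (s / 2 ^ m)) with hδ
  have hn' : (0 : ℝ) < n := by exact_mod_cast hn
  have hδ0 : ∀ m, 0 < δ m := fun m => by positivity
  have hδlim : Tendsto δ atTop (𝓝[>] 0) := by
    refine tendsto_nhdsWithin_iff.2 ⟨?_, Eventually.of_forall hδ0⟩
    have h1 : Tendsto (fun m : ℕ => (2 * (n * s)) * (1 / 2 : ℝ) ^ m) atTop (𝓝 0) := by
      simpa using (tendsto_pow_atTop_nhds_zero_of_lt_one (by norm_num : (0 : ℝ) ≤ 1 / 2)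
        (by norm_num)).const_mul (2 * (n * s))
    refine h1.congr fun m => ?_
    simp only [hδ, one_div, inv_pow]; ring
  have h2 := hx.comp (IsUnifLocDoublingMeasure.tendsto_closedBall_filterAt (volume : Measure (Eu n))
    (K := 1) (x := x) (fun _ => x) δ hδlim (Eventually.of_forall fun m => by simp [(hδ0 m).le]))
  set N : ℝ≥0 := (8 * n) ^ n
  have h3 := ENNReal.Tendsto.const_mul (a := (N : ℝ≥0∞)) h2 (Or.inr (by simp))
  rw [mul_zero] at h3
  refine tendsto_of_tendsto_of_tendsto_of_le_of_le tendsto_const_nhds h3 (fun _ => zero_le)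
    fun m => ?_
  set Q := dyadicCube a s m (dyadicIndex a s m x) with hQ
  have hxQ : x ∈ ball (dyadicCenter a s m (dyadicIndex a s m x)) (n * (s / 2 ^ m)) :=
    dyadicCube_subset_ball hs hn m _ rfl
  have hsub : Q ⊆ closedBall x (δ m) := fun y hy => by
    have hy' := dyadicCube_subset_ball hs hn m _ hy
    rw [mem_ball] at hxQ hy'
    rw [mem_closedBall]
    exact ((dist_triangle_right _ _ _).trans (add_le_add hy'.le hxQ.le)).trans_eq (two_mul _).symm
  have hvol : volume (closedBall x (δ m)) ≤ N * volume Q := by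
    refine (measure_mono (closedBall_subset_ball (lt_two_mul_self (hδ0 m)))).trans
      (volume_ball_le_dyadicCube hs x (8 * n) m _ (le_of_eq ?_))
    simp only [hδ]; push_cast; ring
  have hB0 : volume (closedBall x (δ m)) ≠ 0 := (measure_closedBall_pos _ _ (hδ0 m)).ne'
  have hBt : volume (closedBall x (δ m)) ≠ ∞ := measure_closedBall_lt_top.ne
  refine ENNReal.div_le_of_le_mul ?_
  simp only [Function.comp]
  calc ∫⁻ y in Q, ‖b y - b x‖ₑ ≤ ∫⁻ y in closedBall x (δ m), ‖b y - b x‖ₑ := lintegral_mono_set hsub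
    _ = (∫⁻ y in closedBall x (δ m), ‖b y - b x‖ₑ) / volume (closedBall x (δ m)) *
        volume (closedBall x (δ m)) := (ENNReal.div_mul_cancel hB0 hBt).symm
    _ ≤ (∫⁻ y in closedBall x (δ m), ‖b y - b x‖ₑ) / volume (closedBall x (δ m)) *
        (N * volume Q) := by gcongr
    _ = _ := by ring

/-- The Calderón–Zygmund stopping cubes of `b - c` inside a dyadic cube, at twice the level of its
mean oscillation. -/
theorem exists_stopping_cubes (hs : 0 < s) (hn : 1 ≤ n) {b : Eu n → 𝕜}
    (hb : LocallyIntegrable b volume) {β : ℝ≥0} (hβ0 : 0 < β) (m : ℕ) (k : Fin n → ℤ) (c : 𝕜)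
    (hβ : ∫⁻ y in dyadicCube a s m k, ‖b y - c‖ₑ ≤ β * volume (dyadicCube a s m k)) :
    ∃ J : Set (ℕ × (Fin n → ℤ)), (∀ j ∈ J, dyadicCube a s j.1 j.2 ⊆ dyadicCube a s m k) ∧
      J.PairwiseDisjoint (fun j => dyadicCube a s j.1 j.2) ∧
      2 * volume (⋃ j ∈ J, dyadicCube a s j.1 j.2) ≤ volume (dyadicCube a s m k) ∧
      (∀ᵐ x, x ∈ dyadicCube a s m k → x ∉ ⋃ j ∈ J, dyadicCube a s j.1 j.2 →
        ‖b x - c‖ₑ ≤ 2 * β) ∧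
      ∀ j ∈ J, ‖(⨍ y in dyadicCube a s j.1 j.2, b y) - c‖ₑ ≤
        (((4 * n) ^ n : ℝ≥0) : ℝ≥0∞) * (2 * β) := by
  set Q := dyadicCube a s m k with hQ
  set cube : ℕ → Eu n → Set (Eu n) := fun l x => dyadicCube a s l (dyadicIndex a s l x) with hcube
  have hmem : ∀ l x, x ∈ cube l x := fun l x => rfl
  set P : ℕ → Eu n → Prop := fun l x =>
    2 * (β : ℝ≥0∞) * volume (cube l x) < ∫⁻ y in cube l x, ‖b y - c‖ₑ with hP
  have hPcongr : ∀ {l l' : ℕ} {x y : Eu n}, dyadicIndex a s l x = dyadicIndex a s l y → l' ≤ l →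
      (P l' x ↔ P l' y) := by
    intro l l' x y h hl
    simp only [hP, hcube, dyadicIndex_eq_of_le hl h]
  have hQeq : ∀ x ∈ Q, cube m x = Q := fun x hx => by
    simp only [hcube, hQ]; rw [mem_dyadicCube.1 hx]
  have hPm : ∀ x ∈ Q, ¬ P m x := by
    intro x hx h
    simp only [hP] at h
    rw [hQeq x hx] at h
    refine (h.trans_le hβ).not_ge ?_
    rw [mul_assoc]
    exact le_mul_of_one_le_left zero_le (by norm_num)
  set J : Set (ℕ × (Fin n → ℤ)) := {j | ∃ x ∈ Q, dyadicIndex a s j.1 x = j.2 ∧ m ≤ j.1 ∧ P j.1 x ∧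
    ∀ l, m ≤ l → l < j.1 → ¬ P l x} with hJ
  have hJmem : ∀ j ∈ J, ∀ y ∈ dyadicCube a s j.1 j.2, y ∈ Q ∧ m ≤ j.1 ∧ P j.1 y ∧
      ∀ l, m ≤ l → l < j.1 → ¬ P l y := by
    rintro j ⟨x, hxQ, hx, hmj, hPx, hmin⟩ y hy
    have hxy : dyadicIndex a s j.1 x = dyadicIndex a s j.1 y := hx.trans hy.symm
    refine ⟨?_, hmj, (hPcongr hxy le_rfl).1 hPx,
      fun l hml hlj h => hmin l hml hlj ((hPcongr hxy hlj.le).2 h)⟩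
    rw [hQ, mem_dyadicCube, ← dyadicIndex_eq_of_le hmj hxy]
    exact hxQ
  have hsub : ∀ j ∈ J, dyadicCube a s j.1 j.2 ⊆ Q := fun j hj y hy => (hJmem j hj y hy).1
  have hdisj : J.PairwiseDisjoint (fun j => dyadicCube a s j.1 j.2) := by
    intro i hi j hj hij
    rw [Function.onFun, Set.disjoint_left]
    intro y hyi hyj
    obtain ⟨-, hmi, hPi, hmini⟩ := hJmem i hi y hyi
    obtain ⟨-, hmj, hPj, hminj⟩ := hJmem j hj y hyj
    have h1 : i.1 = j.1 := by
      rcases lt_trichotomy i.1 j.1 with h | h | h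
      · exact absurd hPi (hminj _ hmi h)
      · exact h
      · exact absurd hPj (hmini _ hmj h)
    refine hij (Prod.ext h1 ?_)
    rw [mem_dyadicCube] at hyi hyj
    rw [← hyi, ← hyj, h1]
  have hPcube : ∀ j ∈ J, 2 * (β : ℝ≥0∞) * volume (dyadicCube a s j.1 j.2) ≤
      ∫⁻ y in dyadicCube a s j.1 j.2, ‖b y - c‖ₑ := by
    rintro j ⟨x, -, hx, -, hPx, -⟩
    have := hPx.le
    simp only [hcube, hx] at this
    exact this
  refine ⟨J, hsub, hdisj, ?_, ?_, ?_⟩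
  · have hcount : J.Countable := J.to_countable
    have h1 : 2 * (β : ℝ≥0∞) * volume (⋃ j ∈ J, dyadicCube a s j.1 j.2) ≤ β * volume Q := by
      rw [measure_biUnion hcount hdisj fun j _ => measurableSet_dyadicCube _ _,
        ← ENNReal.tsum_mul_left]
      refine (ENNReal.tsum_le_tsum fun j : J => hPcube j j.2).trans ?_
      rw [← lintegral_biUnion hcount (fun j _ => measurableSet_dyadicCube _ _) hdisj]
      exact (lintegral_mono_set (iUnion₂_subset hsub)).trans hβ
    rw [mul_comm 2 (β : ℝ≥0∞), mul_assoc] at h1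
    exact (ENNReal.mul_le_mul_iff_right (by simpa using hβ0.ne') ENNReal.coe_ne_top).1 h1
  · filter_upwards [ae_tendsto_dyadicCube (a := a) hs hn hb] with x hx hxQ hxU
    have hnP : ∀ l, m ≤ l → ¬ P l x := by
      classical
      by_contra! hcon
      have hfind := Nat.find_spec hcon
      refine hxU (mem_biUnion (x := (Nat.find hcon, dyadicIndex a s (Nat.find hcon) x)) ?_
        (hmem _ x))
      refine ⟨x, hxQ, rfl, hfind.1, hfind.2, fun l hml hl h => Nat.find_min hcon hl ⟨hml, h⟩⟩
    have hlim := hx.const_add (2 * (β : ℝ≥0∞))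
    rw [add_zero] at hlim
    refine ge_of_tendsto hlim ?_
    filter_upwards [eventually_ge_atTop m] with l hl
    have h1 := not_lt.1 (hnP l hl)
    have hv0 : volume (cube l x) ≠ 0 := volume_dyadicCube_ne_zero hs _ _
    have hvt : volume (cube l x) ≠ ∞ := volume_dyadicCube_ne_top hs hn _ _
    have hbm : AEMeasurable (fun y => ‖b y - c‖ₑ) (volume.restrict (cube l x)) :=
      (hb.aestronglyMeasurable.sub aestronglyMeasurable_const).enorm.restrict
    refine (ENNReal.mul_le_mul_iff_left hv0 hvt).1 ?_
    calc ‖b x - c‖ₑ * volume (cube l x) = ∫⁻ y in cube l x, ‖b x - c‖ₑ := by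
          rw [setLIntegral_const]
      _ ≤ ∫⁻ y in cube l x, (‖b y - c‖ₑ + ‖b y - b x‖ₑ) := by
          refine lintegral_mono fun y => ?_
          rw [← enorm_neg (b y - b x), neg_sub, ← sub_add_sub_cancel' (b y) c (b x)]
          exact enorm_add_le _ _
      _ = (∫⁻ y in cube l x, ‖b y - c‖ₑ) + ∫⁻ y in cube l x, ‖b y - b x‖ₑ :=
          lintegral_add_left' hbm _
      _ ≤ 2 * β * volume (cube l x) +
          (∫⁻ y in cube l x, ‖b y - b x‖ₑ) / volume (cube l x) * volume (cube l x) := by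
          rw [ENNReal.div_mul_cancel hv0 hvt]
          gcongr
      _ = _ := by rw [add_mul]
  · intro j hj
    obtain ⟨x, hxQ, hx, hmj, hPx, hmin⟩ := hj
    have hne : m ≠ j.1 := fun h => hPm x hxQ (h ▸ hPx)
    obtain ⟨l, hl⟩ : ∃ l, j.1 = l + 1 := ⟨j.1 - 1, by lia⟩
    have hnP := not_lt.1 (hmin l (by lia) (by lia))
    have hjc : dyadicCube a s j.1 j.2 = cube (l + 1) x := by rw [hcube]; simp only [← hl, hx]
    rw [hjc]
    have hv0 : volume (cube (l + 1) x) ≠ 0 := volume_dyadicCube_ne_zero hs _ _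
    have hvt : volume (cube (l + 1) x) ≠ ∞ := volume_dyadicCube_ne_top hs hn _ _
    have hsubl : cube (l + 1) x ⊆ cube l x := fun y hy => dyadicIndex_eq_of_le (Nat.le_succ l) hy
    refine (ENNReal.mul_le_mul_iff_left hv0 hvt).1 ?_
    refine (enorm_setAverage_sub_mul_le hvt (hb.integrableOn_subset_ball
      (dyadicCube_subset_ball hs hn _ _)) c).trans ?_
    refine (lintegral_mono_set hsubl).trans (hnP.trans ?_)
    calc 2 * (β : ℝ≥0∞) * volume (cube l x)
        ≤ 2 * β * ((((4 * n) ^ n : ℝ≥0) : ℝ≥0∞) * volume (cube (l + 1) x)) := by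
          gcongr
          exact volume_dyadicCube_le_succ hs hn _ _ _
      _ = _ := by ring

/-- The weighted John–Nirenberg inequality on dyadic cubes. -/
theorem measure_dyadicCube_lt_le {ν : Measure (Eu n)} (hν : ν ≪ volume) {η : ℝ≥0} (hs : 0 < s)
    (hn : 1 ≤ n)
    (hη : ∀ (m : ℕ) (k : Fin n → ℤ) (E : Set (Eu n)), MeasurableSet E → E ⊆ dyadicCube a s m k →
      2 * volume E ≤ volume (dyadicCube a s m k) → ν E ≤ η * ν (dyadicCube a s m k))
    {b : Eu n → 𝕜} (hb : LocallyIntegrable b volume) {β : ℝ≥0} (hβ0 : 0 < β)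
    (hβ : ∀ m k, ∫⁻ y in dyadicCube a s m k, ‖b y - ⨍ z in dyadicCube a s m k, b z‖ₑ ≤
      β * volume (dyadicCube a s m k)) (N m : ℕ) (k : Fin n → ℤ) :
    ν {x ∈ dyadicCube a s m k | ((N * ((4 * n) ^ n * (2 * β)) : ℝ≥0) : ℝ≥0∞) <
      ‖b x - ⨍ z in dyadicCube a s m k, b z‖ₑ} ≤ (η ^ N : ℝ≥0) * ν (dyadicCube a s m k) := by
  set L : ℝ≥0 := (4 * n) ^ n * (2 * β) with hL
  have hL1 : 2 * β ≤ L := by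
    refine le_mul_of_one_le_left zero_le (one_le_pow₀ ?_)
    have : (1 : ℝ≥0) ≤ n := by exact_mod_cast hn
    exact this.trans (le_mul_of_one_le_left zero_le (by norm_num))
  induction N generalizing m k with
  | zero =>
    simp only [pow_zero, ENNReal.coe_one, one_mul]
    exact measure_mono fun x hx => hx.1
  | succ N ih =>
    set Q := dyadicCube a s m k with hQ
    set c := ⨍ z in Q, b z with hc
    obtain ⟨J, hsub, hdisj, hvol, hae, havg⟩ := exists_stopping_cubes hs hn hb hβ0 m k c (hβ m k)
    set U := ⋃ j ∈ J, dyadicCube a s j.1 j.2 with hU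
    have hcount : J.Countable := J.to_countable
    have hUm : MeasurableSet U := .biUnion hcount fun j _ => measurableSet_dyadicCube _ _
    set W : ℕ × (Fin n → ℤ) → Set (Eu n) := fun j => {x ∈ dyadicCube a s j.1 j.2 |
      ((N * L : ℝ≥0) : ℝ≥0∞) < ‖b x - ⨍ z in dyadicCube a s j.1 j.2, b z‖ₑ} with hW
    calc ν {x ∈ Q | (((N + 1 : ℕ) * L : ℝ≥0) : ℝ≥0∞) < ‖b x - c‖ₑ} ≤ ν (⋃ j ∈ J, W j) := by
          refine measure_mono_ae ?_
          filter_upwards [hν.ae_le hae] with x hx hxS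
          obtain ⟨hxQ, hxlt⟩ : x ∈ Q ∧ (((N + 1 : ℕ) * L : ℝ≥0) : ℝ≥0∞) < ‖b x - c‖ₑ := hxS
          by_cases hxU : x ∈ U
          · obtain ⟨j, hj, hxj⟩ := mem_iUnion₂.1 hxU
            refine mem_iUnion₂.2 ⟨j, hj, hxj, ?_⟩
            by_contra hcon
            rw [not_lt] at hcon
            refine hxlt.not_ge ?_
            calc ‖b x - c‖ₑ ≤ ‖b x - ⨍ z in dyadicCube a s j.1 j.2, b z‖ₑ +
                  ‖(⨍ z in dyadicCube a s j.1 j.2, b z) - c‖ₑ := by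
                  rw [← sub_add_sub_cancel (b x) (⨍ z in dyadicCube a s j.1 j.2, b z) c]
                  exact enorm_add_le _ _
              _ ≤ (N * L : ℝ≥0) + (L : ℝ≥0) := by
                  refine add_le_add hcon ((havg j hj).trans_eq ?_)
                  rw [hL]; push_cast; rfl
              _ = _ := by push_cast; ring
          · refine absurd ((hx hxQ hxU).trans ?_) hxlt.not_ge
            have : 2 * β ≤ (N + 1 : ℕ) * L := by
              refine hL1.trans (le_mul_of_one_le_left zero_le ?_)
              exact_mod_cast Nat.le_add_left 1 N
            exact_mod_cast this
      _ ≤ ∑' j : J, ν (W j) := measure_biUnion_le ν hcount _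
      _ ≤ ∑' j : J, (η ^ N : ℝ≥0) * ν (dyadicCube a s j.1.1 j.1.2) :=
          ENNReal.tsum_le_tsum fun j => ih _ _
      _ = (η ^ N : ℝ≥0) * ν U := by
          rw [ENNReal.tsum_mul_left, hU,
            measure_biUnion hcount hdisj fun j _ => measurableSet_dyadicCube _ _]
      _ ≤ (η ^ N : ℝ≥0) * (η * ν Q) := by
          gcongr
          exact hη m k U hUm (iUnion₂_subset hsub) hvol
      _ = _ := by rw [pow_succ]; push_cast; ring

end JohnNirenberg

theorem summable_rpow_mul_geometric {η : ℝ≥0} (hη : η < 1) (L : ℝ≥0) (q : ℝ) :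
    Summable fun N : ℕ => ((N + 1 : ℕ) * L) ^ q * η ^ N := by
  set d := ⌈q⌉₊ with hd
  have h1 : Summable fun N : ℕ => L ^ q * (2 ^ (d - 1) * ((N : ℝ≥0) ^ d * η ^ N + η ^ N)) := by
    refine Summable.mul_left _ (Summable.mul_left _ (Summable.add ?_ ?_))
    · rw [← NNReal.summable_coe]
      simpa using summable_pow_mul_geometric_of_norm_lt_one (R := ℝ) d (r := (η : ℝ)) (by simpa)
    · exact NNReal.summable_geometric hη
  refine NNReal.summable_of_le (fun N => ?_) h1
  rw [NNReal.mul_rpow, mul_comm _ (L ^ q), mul_assoc]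
  refine mul_le_mul_right ?_ _
  have h2 : ((N + 1 : ℕ) : ℝ≥0) ^ q ≤ ((N + 1 : ℕ) : ℝ≥0) ^ d := by
    rw [← NNReal.rpow_natCast]
    exact NNReal.rpow_le_rpow_of_exponent_le (by exact_mod_cast Nat.le_add_left 1 N)
      (Nat.le_ceil q)
  have h3 : ((N + 1 : ℕ) : ℝ≥0) ^ d ≤ 2 ^ (d - 1) * ((N : ℝ≥0) ^ d + 1) := by
    push_cast
    exact (add_pow_le zero_le zero_le d).trans_eq (by rw [one_pow])
  calc ((N + 1 : ℕ) : ℝ≥0) ^ q * η ^ N ≤ (2 ^ (d - 1) * ((N : ℝ≥0) ^ d + 1)) * η ^ N := by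
        gcongr
        exact h2.trans h3
    _ = _ := by ring

/-- Exponential decay of the distribution function gives all moments. -/
theorem lintegral_rpow_le_of_measure_lt_le {α : Type*} [MeasurableSpace α] {μ : Measure α}
    {v : α → ℝ≥0∞} (hv : AEMeasurable v μ) (hvt : ∀ x, v x ≠ ∞) {η L : ℝ≥0} (hη : η < 1)
    (hL : 0 < L) (h : ∀ N : ℕ, μ {x | ((N * L : ℝ≥0) : ℝ≥0∞) < v x} ≤ (η ^ N : ℝ≥0) * μ univ)
    {q : ℝ} (hq : 0 < q) :
    ∫⁻ x, v x ^ q ∂μ ≤ ((∑' N : ℕ, ((N + 1 : ℕ) * L) ^ q * η ^ N : ℝ≥0) : ℝ≥0∞) * μ univ := by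
  set S : ℕ → Set α := fun N => {x | ((N * L : ℝ≥0) : ℝ≥0∞) < v x} with hS
  have hSm : ∀ N, NullMeasurableSet (S N) μ := fun N => nullMeasurableSet_lt aemeasurable_const hv
  set g : ℕ → α → ℝ≥0∞ := fun N => (S N).indicator fun _ => ((((N + 1 : ℕ) * L) ^ q : ℝ≥0) : ℝ≥0∞)
  have hpt : ∀ x, v x ^ q ≤ ∑' N, g N x := by
    intro x
    rcases eq_or_ne (v x) 0 with h0 | h0
    · simp [h0, ENNReal.zero_rpow_of_pos hq]
    lift v x to ℝ≥0 using hvt x with y hy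
    have hy0 : 0 < y := by simpa [pos_iff_ne_zero] using h0
    have hex : ∃ N : ℕ, y ≤ (N + 1 : ℕ) * L := by
      obtain ⟨N, hN⟩ := exists_nat_ge (y / L)
      refine ⟨N, ?_⟩
      rw [div_le_iff₀ hL] at hN
      refine hN.trans ?_
      gcongr
      exact Nat.le_succ N
    classical
    have hle := Nat.find_spec hex
    have hlt : (Nat.find hex : ℝ≥0) * L < y := by
      rcases Nat.eq_zero_or_pos (Nat.find hex) with h1 | h1
      · rw [h1]; simpa using hy0
      · have h2 := Nat.find_min hex (Nat.sub_lt h1 one_pos)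
        rwa [not_le, Nat.sub_add_cancel (Nat.one_le_iff_ne_zero.2 h1.ne')] at h2
    have hmem : x ∈ S (Nat.find hex) := by
      change ((_ : ℝ≥0) : ℝ≥0∞) < v x
      rw [← hy]
      exact_mod_cast hlt
    refine le_trans ?_ (ENNReal.le_tsum (Nat.find hex))
    change _ ≤ (S _).indicator _ x
    rw [indicator_of_mem hmem, ← ENNReal.coe_rpow_of_nonneg _ hq.le]
    exact ENNReal.coe_le_coe.2 (NNReal.rpow_le_rpow hle hq.le)
  calc ∫⁻ x, v x ^ q ∂μ ≤ ∫⁻ x, ∑' N, g N x ∂μ := lintegral_mono hpt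
    _ = ∑' N, ∫⁻ x, g N x ∂μ := lintegral_tsum fun N => aemeasurable_const.indicator₀ (hSm N)
    _ = ∑' N, ((((N + 1 : ℕ) * L) ^ q : ℝ≥0) : ℝ≥0∞) * μ (S N) := by
        refine tsum_congr fun N => ?_
        rw [lintegral_indicator_const₀ (hSm N)]
    _ ≤ ∑' N, ((((N + 1 : ℕ) * L) ^ q : ℝ≥0) : ℝ≥0∞) * ((η ^ N : ℝ≥0) * μ univ) :=
        ENNReal.tsum_le_tsum fun N => by gcongr; exact h N
    _ = _ := by
        rw [ENNReal.coe_tsum (summable_rpow_mul_geometric hη L q), ← ENNReal.tsum_mul_right]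
        refine tsum_congr fun N => ?_
        push_cast; ring

/-- The weighted mean oscillations of a `BMO` function, with respect to a Muckenhoupt measure and
with any exponent, are bounded. -/
theorem IsMuckenhoupt.exists_lintegral_ball_rpow_le {p : ℝ} {C : ℝ≥0} {ν : Measure (Eu n)}
    (h : IsMuckenhoupt p C ν) (hp : 0 < p) (hn : 1 ≤ n) {b : Eu n → 𝕜} (hb : MemBMO b) {q : ℝ}
    (hq : 1 ≤ q) :
    ∃ A : ℝ≥0, ∀ (x : Eu n) (r : ℝ), 0 < r →
      ∫⁻ y in ball x r, ‖b y - ⨍ z in ball x r, b z‖ₑ ^ q ∂ν ≤ A * ν (ball x r) := by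
  have hq0 : 0 < q := by linarith
  obtain ⟨η, hη1, hη⟩ := h.exists_measure_dyadicCube_le hp hn
  set β₀ : ℝ≥0 := 2 * (bmoNorm b).toNNReal * (2 * n) ^ n with hβ₀
  set β : ℝ≥0 := β₀ + 1 with hβ_def
  have hβ0 : 0 < β := by positivity
  have hβ : ∀ (a : Eu n) (s : ℝ), 0 < s → ∀ m k,
      ∫⁻ y in dyadicCube a s m k, ‖b y - ⨍ z in dyadicCube a s m k, b z‖ₑ ≤
        β * volume (dyadicCube a s m k) := by
    intro a s hs m k
    refine (MemBMO.lintegral_dyadicCube_le hs hn hb m k).trans ?_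
    gcongr
    rw [hβ_def, hβ₀]
    push_cast
    rw [ENNReal.coe_toNNReal hb.norm_lt_top.ne]
    exact le_self_add
  set L : ℝ≥0 := (4 * n) ^ n * (2 * β) with hL
  have hn0 : (0 : ℝ≥0) < n := by exact_mod_cast hn
  have hL0 : 0 < L := by positivity
  set A₁ : ℝ≥0 := ∑' N : ℕ, ((N + 1 : ℕ) * L) ^ q * η ^ N with hA₁
  set D : ℝ≥0 := (C * (2 * n) ^ n) ^ p with hD
  refine ⟨2 ^ (q - 1) * (A₁ * D + ((2 * n) ^ n * β) ^ q), fun x r hr => ?_⟩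
  set a : Eu n := WithLp.toLp 2 fun i => x i - r with ha
  have hs : 0 < 2 * r := by positivity
  set Q := dyadicCube a (2 * r) 0 0 with hQ
  have hctr : dyadicCenter a (2 * r) 0 0 = x := by
    ext i
    simp only [dyadicCenter, ha, pow_zero, div_one, Pi.zero_apply, Int.cast_zero]
    ring
  have hBQ : ball x r ⊆ Q := by
    have := ball_subset_dyadicCube (a := a) hs 0 0
    rw [hctr] at this
    simpa using this
  have hQB : Q ⊆ ball x (n * (2 * r)) := by
    have := dyadicCube_subset_ball (a := a) hs hn 0 0
    rw [hctr] at this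
    simpa using this
  have hnr : 0 < (n : ℝ) * (2 * r) := by positivity
  have hQm : MeasurableSet Q := measurableSet_dyadicCube 0 0
  have hn1 : (1 : ℝ) ≤ n := by exact_mod_cast hn
  have hνQ : ν Q ≤ D * ν (ball x r) := (measure_mono hQB).trans
    (h.measure_ball_le_ball hp hr (ball_subset_ball (by nlinarith)) hnr (2 * n)
      (le_of_eq (by push_cast; ring)))
  have hvolQ : volume Q ≤ (((2 * n) ^ n : ℝ≥0) : ℝ≥0∞) * volume (ball x r) :=
    (measure_mono hQB).trans (volume_ball_le_mul x x (2 * n) hr (le_of_eq (by push_cast; ring)))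
  set cQ := ⨍ z in Q, b z with hcQ
  set cB := ⨍ z in ball x r, b z with hcB
  have hQint : ∫⁻ y in Q, ‖b y - cQ‖ₑ ^ q ∂ν ≤ A₁ * ν Q := by
    have hm : AEMeasurable (fun y => ‖b y - cQ‖ₑ) (ν.restrict Q) :=
      ((hb.locallyIntegrable.aestronglyMeasurable.mono_ac h.ac).sub
        aestronglyMeasurable_const).enorm.restrict
    have := lintegral_rpow_le_of_measure_lt_le hm (fun _ => enorm_ne_top) hη1 hL0 (fun N => ?_) hq0
    · rwa [Measure.restrict_apply_univ] at this
    · rw [Measure.restrict_apply_univ, Measure.restrict_apply' hQm, inter_comm]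
      exact measure_dyadicCube_lt_le h.ac hs hn (hη a (2 * r) hs) hb.locallyIntegrable hβ0
        (hβ a (2 * r) hs) N 0 0
  have hc : ‖cQ - cB‖ₑ ≤ ((2 * n) ^ n * β : ℝ≥0) := by
    have hB0 := volume_ball_pos' x hr
    have hBt : volume (ball x r) ≠ ∞ := measure_ball_lt_top.ne
    rw [← enorm_neg, neg_sub]
    refine (ENNReal.mul_le_mul_iff_left hB0 hBt).1 ?_
    refine (enorm_setAverage_sub_mul_le hBt
      (hb.locallyIntegrable.integrableOn_subset_ball subset_rfl) cQ).trans ?_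
    refine (lintegral_mono_set hBQ).trans ((hβ a (2 * r) hs 0 0).trans ?_)
    calc (β : ℝ≥0∞) * volume Q ≤ β * ((((2 * n) ^ n : ℝ≥0) : ℝ≥0∞) * volume (ball x r)) := by gcongr
      _ = _ := by push_cast; ring
  calc ∫⁻ y in ball x r, ‖b y - cB‖ₑ ^ q ∂ν
      ≤ ∫⁻ y in ball x r, 2 ^ (q - 1) * (‖b y - cQ‖ₑ ^ q + ‖cQ - cB‖ₑ ^ q) ∂ν := by
        refine lintegral_mono fun y => ?_
        refine le_trans ?_ (ENNReal.rpow_add_le_mul_rpow_add_rpow _ _ hq)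
        refine ENNReal.rpow_le_rpow ?_ hq0.le
        rw [← sub_add_sub_cancel (b y) cQ cB]
        exact enorm_add_le _ _
    _ = 2 ^ (q - 1) * ((∫⁻ y in ball x r, ‖b y - cQ‖ₑ ^ q ∂ν) + ‖cQ - cB‖ₑ ^ q * ν (ball x r)) := by
        rw [lintegral_const_mul' _ _ (ENNReal.rpow_ne_top_of_nonneg (by linarith) (by simp)),
          lintegral_add_right _ measurable_const, setLIntegral_const]
    _ ≤ 2 ^ (q - 1) * (A₁ * (D * ν (ball x r)) +
          ((2 * n) ^ n * β : ℝ≥0) ^ q * ν (ball x r)) := by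
        refine mul_le_mul_right (add_le_add ?_ ?_) _
        · exact (lintegral_mono_set hBQ).trans (hQint.trans (mul_le_mul_right hνQ _))
        · gcongr
    _ = _ := by
        have e : (2 : ℝ≥0∞) ^ (q - 1) = ((2 ^ (q - 1) : ℝ≥0) : ℝ≥0∞) := by
          rw [ENNReal.coe_rpow_of_nonneg _ (by linarith), ENNReal.coe_ofNat]
        rw [← ENNReal.coe_rpow_of_nonneg _ hq0.le, e, ENNReal.coe_mul, ENNReal.coe_add,
          ENNReal.coe_mul]
        ring

/-- The averages of a `BMO` function over dyadic dilates of a ball grow at most linearly. -/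
theorem MemBMO.enorm_setAverage_sub_le {b : Eu n → 𝕜} (hb : MemBMO b) (x : Eu n) {r : ℝ}
    (hr : 0 < r) (i : ℕ) :
    ‖(⨍ z in ball x (2 ^ i * r), b z) - ⨍ z in ball x r, b z‖ₑ ≤ i * (2 ^ n * bmoNorm b) := by
  induction i with
  | zero => simp
  | succ i ih =>
    have hri : 0 < 2 ^ i * r := by positivity
    have hB0 := volume_ball_pos' x hri
    have hBt : volume (ball x (2 ^ i * r)) ≠ ∞ := measure_ball_lt_top.ne
    have h1 : ‖(⨍ z in ball x (2 ^ (i + 1) * r), b z) - ⨍ z in ball x (2 ^ i * r), b z‖ₑ ≤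
        2 ^ n * bmoNorm b := by
      rw [← enorm_neg, neg_sub]
      refine (ENNReal.mul_le_mul_iff_left hB0 hBt).1 ?_
      refine (enorm_setAverage_sub_mul_le hBt
        (hb.locallyIntegrable.integrableOn_subset_ball subset_rfl) _).trans ?_
      have hsub : ball x (2 ^ i * r) ⊆ ball x (2 ^ (i + 1) * r) :=
        ball_subset_ball (by rw [pow_succ]; linarith)
      refine (lintegral_mono_set hsub).trans
        ((MemBMO.lintegral_ball_le x (by positivity)).trans ?_)
      calc bmoNorm b * volume (ball x (2 ^ (i + 1) * r))
          ≤ bmoNorm b * (((2 ^ n : ℝ≥0) : ℝ≥0∞) * volume (ball x (2 ^ i * r))) := by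
            gcongr
            exact volume_ball_le_mul x x 2 hri (le_of_eq (by push_cast; ring))
        _ = _ := by push_cast; ring
    rw [← sub_add_sub_cancel _ (⨍ z in ball x (2 ^ i * r), b z)]
    refine (enorm_add_le _ _).trans ((add_le_add h1 ih).trans_eq ?_)
    push_cast; ring

theorem hasMajorant_commKernel {p κ : ℝ} {w : Eu n → ℝ} (hp : 1 < p) (hn : 1 ≤ n) (hκ : κ < 1)
    (hw : IsAp p w) {b : Eu n → 𝕜} (hb : MemBMO b) : HasMajorant (commKernel b) p κ w 𝕜 := by
  obtain ⟨C, hν, hσ, hdual, hholder⟩ := hw.exists_isMuckenhoupt hp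
  have hp0 : 0 < p := by linarith
  set q := p / (p - 1) with hq_def
  have hpq : p.HolderConjugate q := Real.HolderConjugate.conjExponent hp
  have hq0 : 0 < q := hpq.symm.pos
  set σ := volume.withDensity (dualDensity p w) with hσ_def
  obtain ⟨c, hc⟩ := exists_lintegral_czKernel_le n
  obtain ⟨S, hS⟩ := hν.exists_tsum_le hp0 hn hκ
  obtain ⟨A₁, hA₁⟩ := hν.exists_lintegral_ball_rpow_le hp0 hn hb hp.le
  obtain ⟨A₂, hA₂⟩ := hσ.exists_lintegral_ball_rpow_le hq0 hn hb hpq.symm.lt.le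
  set β : ℝ≥0 := (bmoNorm b).toNNReal with hβ
  have hβc : (β : ℝ≥0∞) = bmoNorm b := ENNReal.coe_toNNReal hb.norm_lt_top.ne
  set κ₀ : ℝ≥0 := 2 * (2 ^ n * β) + A₂ ^ (1 / q) with hκ₀
  refine ⟨c * C * S * (A₁ ^ (1 / p) + κ₀), fun f hf x₀ r hr => ?_⟩
  set M := morreyNorm p κ w f with hM
  have hMt : M ≠ ∞ := hf.norm_lt_top.ne
  have hfm := hf.locallyIntegrable.aestronglyMeasurable
  have hbm := hb.locallyIntegrable.aestronglyMeasurable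
  set ν := wMeas w (ball x₀ r) with hν_def
  have hν0 : ν ≠ 0 := (hν.pos x₀ r hr).ne'
  have hνt : ν ≠ ∞ := (hν.lt_top x₀ r).ne
  have hνs : ν ^ (-((1 - κ) / p)) ≠ ∞ := ENNReal.rpow_ne_top_of_ne_zero hν0 hνt
  set bB := ⨍ z in ball x₀ r, b z with hbB
  have hosc : ∀ i : ℕ, (volume (ball x₀ (2 ^ i * (4 * r))))⁻¹ *
      ∫⁻ y in ball x₀ (2 ^ i * (4 * r)), ‖b y - ⨍ z in ball x₀ (2 ^ i * (4 * r)), b z‖ₑ * ‖f y‖ₑ ≤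
      C * M * (A₂ ^ (1 / q) : ℝ≥0) *
        wMeas w (ball x₀ (2 ^ i * (4 * r))) ^ (-((1 - κ) / p)) := by
    intro i
    have hR : 0 < 2 ^ i * (4 * r) := by positivity
    set B := ball x₀ (2 ^ i * (4 * r)) with hB
    have hB0 : volume B ≠ 0 := volume_ball_pos' x₀ hR
    have hBt : volume B ≠ ∞ := measure_ball_lt_top.ne
    have hw0 : wMeas w B ≠ 0 := (hν.pos x₀ _ hR).ne'
    have hwt : wMeas w B ≠ ∞ := (hν.lt_top x₀ _).ne
    have h1 := hholder x₀ (2 ^ i * (4 * r)) (fun y => ‖f y‖ₑ)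
      (fun y => ‖b y - ⨍ z in B, b z‖ₑ) hfm.enorm (hbm.sub aestronglyMeasurable_const).enorm
    rw [← eLpNorm_eq_lintegral hp0] at h1
    have h2 := eLpNorm_ball_le_morreyNorm (κ := κ) hν f x₀ hR
    have h3 := ENNReal.rpow_le_rpow (hA₂ x₀ _ hR) (z := 1 / q) (by positivity)
    rw [ENNReal.mul_rpow_of_nonneg _ _ (by positivity),
      ← ENNReal.coe_rpow_of_nonneg _ (by positivity)] at h3
    simp_rw [mul_comm (‖b _ - _‖ₑ)]
    set I := ∫⁻ y in B, ‖f y‖ₑ * ‖b y - ⨍ z in B, b z‖ₑ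
    calc (volume B)⁻¹ * I
        ≤ (volume B)⁻¹ * ((M * wMeas w B ^ (κ / p)) * ((A₂ ^ (1 / q) : ℝ≥0) * σ B ^ (1 / q))) := by
          gcongr
          exact h1.trans (mul_le_mul' h2 h3)
      _ = (volume B)⁻¹ * (wMeas w B ^ (1 / p) * σ B ^ (1 / q)) * wMeas w B ^ (-(1 / p)) *
            (M * wMeas w B ^ (κ / p) * (A₂ ^ (1 / q) : ℝ≥0)) := by
          have e : wMeas w B ^ (1 / p) * wMeas w B ^ (-(1 / p)) = 1 := by
            rw [← ENNReal.rpow_add _ _ hw0 hwt]; simp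
          calc _ = (volume B)⁻¹ * ((M * wMeas w B ^ (κ / p)) *
                ((A₂ ^ (1 / q) : ℝ≥0) * σ B ^ (1 / q))) *
                (wMeas w B ^ (1 / p) * wMeas w B ^ (-(1 / p))) := by rw [e, mul_one]
            _ = _ := by ring
      _ ≤ (volume B)⁻¹ * (C * volume B) * wMeas w B ^ (-(1 / p)) *
            (M * wMeas w B ^ (κ / p) * (A₂ ^ (1 / q) : ℝ≥0)) := by
          exact mul_le_mul_left (mul_le_mul_left (mul_le_mul_right (hdual x₀ _ hR) _) _) _
      _ = ((volume B)⁻¹ * volume B) * (C * M * (A₂ ^ (1 / q) : ℝ≥0) *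
            (wMeas w B ^ (-(1 / p)) * wMeas w B ^ (κ / p))) := by ring
      _ = _ := by
          rw [ENNReal.inv_mul_cancel hB0 hBt, one_mul, ← ENNReal.rpow_add _ _ hw0 hwt]
          congr 2; ring
  set h : Eu n → ℝ≥0∞ := fun x =>
    (c * C * S : ℝ≥0) * M * ν ^ (-((1 - κ) / p)) * (‖b x - bB‖ₑ + κ₀) with hh
  refine ⟨h, fun x => ?_, ?_, fun x hx => ?_, ?_⟩
  · exact (ENNReal.mul_ne_top (ENNReal.mul_ne_top (ENNReal.mul_ne_top ENNReal.coe_ne_top hMt) hνs)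
      (ENNReal.add_ne_top.2 ⟨enorm_ne_top, by simp⟩)).lt_top
  · exact ((hbm.sub aestronglyMeasurable_const).enorm.add_const _).const_mul _
  · have h1 : ∀ y, commKernel b x y * ‖f y‖ₑ = czKernel x y * (‖b x - b y‖ₑ * ‖f y‖ₑ) := fun y => by
      rw [commKernel, czKernel]; ring
    simp_rw [h1]
    refine (hc x₀ r hr x hx _).trans ?_
    have h2 := hS x₀ r hr (C * M * (‖b x - bB‖ₑ + κ₀))
      (fun i => (volume (ball x₀ (2 ^ i * (4 * r))))⁻¹ *
        ∫⁻ y in ball x₀ (2 ^ i * (4 * r)), ‖b x - b y‖ₑ * ‖f y‖ₑ) fun i => ?_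
    · refine (mul_le_mul_right h2 _).trans_eq ?_
      rw [hh]; push_cast; ring
    have hR : 0 < 2 ^ i * (4 * r) := by positivity
    have hosci := hosc i
    have havg := laverage_le_morreyNorm (κ := κ) hν hp0 hfm x₀ hR
    have hbi : ‖bB - ⨍ z in ball x₀ (2 ^ i * (4 * r)), b z‖ₑ ≤
        (i + 1 : ℕ) * ((2 * (2 ^ n * β) : ℝ≥0) : ℝ≥0∞) := by
      have h3 := hb.enorm_setAverage_sub_le x₀ hr (i + 2)
      have e : (2 : ℝ) ^ (i + 2) * r = 2 ^ i * (4 * r) := by rw [pow_add]; ring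
      rw [e, ← enorm_neg, neg_sub, ← hβc] at h3
      have h4 : ((i + 2 : ℕ) : ℝ≥0∞) ≤ (i + 1 : ℕ) * 2 := by
        exact_mod_cast (by lia : i + 2 ≤ (i + 1) * 2)
      refine h3.trans ((mul_le_mul_left h4 _).trans_eq ?_)
      push_cast; ring
    set B := ball x₀ (2 ^ i * (4 * r)) with hB
    set bi := ⨍ z in B, b z with hbi_def
    set s := wMeas w B ^ (-((1 - κ) / p)) with hs
    have hone : (1 : ℝ≥0∞) ≤ (i + 1 : ℕ) := by exact_mod_cast Nat.le_add_left 1 i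
    calc (volume B)⁻¹ * ∫⁻ y in B, ‖b x - b y‖ₑ * ‖f y‖ₑ
        ≤ (volume B)⁻¹ * ∫⁻ y in B, ((‖b x - bB‖ₑ + ‖bB - bi‖ₑ) * ‖f y‖ₑ +
            ‖b y - bi‖ₑ * ‖f y‖ₑ) := by
          gcongr with y
          rw [← add_mul]
          gcongr
          have e : b x - b y = (b x - bB) + (bB - bi) - (b y - bi) := by ring
          rw [e]
          exact enorm_sub_le.trans (add_le_add_left (enorm_add_le _ _) _)
      _ = (‖b x - bB‖ₑ + ‖bB - bi‖ₑ) * ((volume B)⁻¹ * ∫⁻ y in B, ‖f y‖ₑ) +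
            (volume B)⁻¹ * ∫⁻ y in B, ‖b y - bi‖ₑ * ‖f y‖ₑ := by
          rw [lintegral_add_left' (hfm.enorm.const_mul _).restrict,
            lintegral_const_mul' _ _ (ENNReal.add_ne_top.2 ⟨enorm_ne_top, enorm_ne_top⟩)]
          ring
      _ ≤ (‖b x - bB‖ₑ * (i + 1 : ℕ) + (i + 1 : ℕ) * ((2 * (2 ^ n * β) : ℝ≥0) : ℝ≥0∞)) *
            (C * M * s) + C * M * (A₂ ^ (1 / q) : ℝ≥0) * s * (i + 1 : ℕ) := by
          exact add_le_add (mul_le_mul' (add_le_add (le_mul_of_one_le_right zero_le hone) hbi) havg)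
            (hosci.trans (le_mul_of_one_le_right zero_le hone))
      _ = _ := by
          rw [hκ₀, ENNReal.coe_add]; ring
  · have hpt : ∀ y, h y ^ p = ((c * C * S : ℝ≥0) * M * ν ^ (-((1 - κ) / p))) ^ p *
        (‖b y - bB‖ₑ + κ₀) ^ p := fun y => ENNReal.mul_rpow_of_nonneg _ _ hp0.le
    have hct : (((c * C * S : ℝ≥0) : ℝ≥0∞) * M * ν ^ (-((1 - κ) / p))) ≠ ∞ :=
      ENNReal.mul_ne_top (ENNReal.mul_ne_top ENNReal.coe_ne_top hMt) hνs
    simp_rw [hpt]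
    rw [lintegral_const_mul' _ _ (ENNReal.rpow_ne_top_of_nonneg hp0.le hct),
      ENNReal.mul_rpow_of_nonneg _ _ (by positivity), ← ENNReal.rpow_mul,
      mul_one_div_cancel hp0.ne', ENNReal.rpow_one]
    have h1 : (∫⁻ y in ball x₀ r, (‖b y - bB‖ₑ + κ₀) ^ p ∂wMeas w) ^ (1 / p) ≤
        ((A₁ ^ (1 / p) + κ₀ : ℝ≥0) : ℝ≥0∞) * ν ^ (1 / p) := by
      refine (ENNReal.lintegral_Lp_add_le (f := fun y => ‖b y - bB‖ₑ) (g := fun _ => (κ₀ : ℝ≥0∞))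
        ((hbm.mono_ac hν.ac).sub aestronglyMeasurable_const).enorm.restrict
        aemeasurable_const hp.le).trans ?_
      rw [setLIntegral_const, ENNReal.mul_rpow_of_nonneg _ _ (by positivity), ← ENNReal.rpow_mul,
        mul_one_div_cancel hp0.ne', ENNReal.rpow_one, ENNReal.coe_add (A₁ ^ (1 / p)),
        add_mul ((A₁ ^ (1 / p) : ℝ≥0) : ℝ≥0∞)]
      refine add_le_add ?_ le_rfl
      have h2 := ENNReal.rpow_le_rpow (hA₁ x₀ r hr) (z := 1 / p) (by positivity)
      rwa [ENNReal.mul_rpow_of_nonneg _ _ (by positivity),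
        ← ENNReal.coe_rpow_of_nonneg _ (by positivity)] at h2
    calc _ ≤ (((c * C * S : ℝ≥0) : ℝ≥0∞) * M * ν ^ (-((1 - κ) / p))) *
          (((A₁ ^ (1 / p) + κ₀ : ℝ≥0) : ℝ≥0∞) * ν ^ (1 / p)) := by gcongr
      _ = (c * C * S * (A₁ ^ (1 / p) + κ₀) : ℝ≥0) * M *
          (ν ^ (-((1 - κ) / p)) * ν ^ (1 / p)) := by
          rw [ENNReal.coe_mul (c * C * S)]; ring
      _ = _ := by
          rw [← ENNReal.rpow_add _ _ hν0 hνt]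
          congr 2; ring

end WeightedMorrey

end

theorem corollary4 {𝕜 : Type*} [RCLike 𝕜] {n : ℕ} (hn : 1 ≤ n)
    (κ : ℝ) (hκ0 : 0 < κ) (hκ1 : κ < 1)
    (w : WeightedMorrey.Eu n → ℝ)
    (D : Submodule 𝕜 (WeightedMorrey.Eu n → 𝕜))
    (T : (WeightedMorrey.Eu n → 𝕜) → WeightedMorrey.Eu n → 𝕜)
    (hT : WeightedMorrey.IsSublinearOn D T) :
    (WeightedMorrey.SizeCondition WeightedMorrey.czKernel D T →
      (∀ p : ℝ, 1 < p → WeightedMorrey.IsAp p w → WeightedMorrey.BoundedOnLp p w D T →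
        WeightedMorrey.BoundedOnMorrey WeightedMorrey.czKernel p κ w D T) ∧
      (WeightedMorrey.IsA1 w → WeightedMorrey.BoundedWeakL1 w D T →
        WeightedMorrey.BoundedToWeakMorrey WeightedMorrey.czKernel 1 κ w D T)) ∧
    (∀ b : WeightedMorrey.Eu n → 𝕜, WeightedMorrey.MemBMO b →
      WeightedMorrey.SizeCondition (WeightedMorrey.commKernel b) D T →
      ∀ p : ℝ, 1 < p → WeightedMorrey.IsAp p w → WeightedMorrey.BoundedOnLp p w D T →
        WeightedMorrey.BoundedOnMorrey (WeightedMorrey.commKernel b) p κ w D T) := by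
  refine ⟨fun hs => ⟨fun p hp hw hA => ?_, fun hw hA => ?_⟩, fun b hb hs p hp hw hA => ?_⟩
  · obtain ⟨C, hν, -⟩ := hw.exists_isMuckenhoupt hp
    exact WeightedMorrey.boundedOnMorrey_of_hasMajorant hν hp.le hκ0.le
      hw.isWeight.volume_absolutelyContinuous hT hA hs
      (WeightedMorrey.hasMajorant_czKernel hν (by linarith) hn hκ1)
  · obtain ⟨C, hν⟩ := hw.exists_isMuckenhoupt
    exact WeightedMorrey.boundedToWeakMorrey_of_hasMajorant hν hκ0.le
      hw.isWeight.volume_absolutelyContinuous hT hA hs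
      (WeightedMorrey.hasMajorant_czKernel hν one_pos hn hκ1)
  · obtain ⟨C, hν, -⟩ := hw.exists_isMuckenhoupt hp
    exact WeightedMorrey.boundedOnMorrey_of_hasMajorant hν hp.le hκ0.le
      hw.isWeight.volume_absolutelyContinuous hT hA hs
      (WeightedMorrey.hasMajorant_commKernel hp hn hκ1 hw hb)
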